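/- Let $0\le\beta<1/2$ and write $L^2=L^2([0,1],dt)$, $l^2=l^2(\mathbf N)$ with canonical basis $(x_n)$. For $\alpha>0$ let $(I^\alpha_{0^+}f)(x)=\frac1{\Gamma(\alpha)}\int_0^x f(t)(x-t)^{\alpha-1}dt$ and $(I^\alpha_{1^-}f)(x)=\frac1{\Gamma(\alpha)}\int_x^1 f(t)(t-x)^{\alpha-1}dt$, and let $I^0_{0^+}=\mathrm{Id}$. Let $(e_n)$ be a complete orthonormal basis of $L^2$ and $k_n=I_{1^-}^{1-\beta}e_n$. For $f=I^\beta_{0^+}g$ with $g\in L^2$ put $\mathfrak J_\beta f=\sum_n\bigl(\int_0^1 g(s)e_n(s)\,ds\bigr)x_n\in l^2$. Let $m_\beta$ be the centered Gaussian measure on $l^2$ with covariance operator $S_\beta=\sum_{n,l}\bigl(\int_0^1k_nk_l\,ds\bigr)x_n\otimes x_l$. For an integer $m\ge1$, let $B_m^\dagger$ be the linear interpolation of a Brownian motion $B$ on the mesh $1/m$, i.e. $B_m^\dagger(0)=0$ and $dB_m^\dagger(t)=m\sum_{i=0}^{m-1}\bigl(B(\tfrac{i+1}m)-B(\tfrac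 im)\bigr)\mathbf 1_{[i/m,(i+1)/m)}(t)\,dt$, and let $\nu_m^\dagger$ be the law of $\mathfrak J_\beta B_m^\dagger$ on $l^2$. Let $p_m$ be the orthogonal projection of $L^2$ onto the span of the indicators $\mathbf 1_{[i/m,(i+1)/m)}$, $0\le i<m$, let $S_m^\dagger=\sum_{n,l}\bigl(\int_0^1 (p_mk_n)(p_mk_l)\,ds\bigr)x_n\otimes x_l$, and let $\gamma^\dagger_{m,\beta}=\sum_n|\langle(S_m^\dagger-S_\beta)x_n,x_n\rangle|$. For $k\ge1$, $\mathcal C_b^k(l^2;\mathbf R)$ is the set of $k$ times Fréchet differentiable $F:l^2\to\mathbf R$ with $\|F\|_{\mathcal C^k_b}:=\sup_{1\le j\le k}\sup_{x\in l^2}\|\nabla^{(j)}F(x)\|_{(l^2)^{\otimes j}}<\infty$, where $(l^2)^{\otimes j}$ is the Hilbert space tensor power. **Theorem.** The operator $S_m^\dagger-S_\beta$ has a finite trace in the sense that $\gamma^\dagger_{m,\beta}<\infty$, and for every $m\ge1$, every integer $s\ge0$ and every $F\in\mathcal C_b^{2s+2}(l^2;\mathbf R)$, all the integrals below being well defined,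 $$\int_{l^2} F\,d\nu_m^\dagger=\sum_{j=0}^s\frac1{2^j\,j!}\int_{l^2}\bigl\langle\nabla^{(2j)}F(u),(S_m^\dagger-S_\beta)^{\otimes j}\bigr\rangle_{(l^2)^{\otimes 2j}}\,dm_\beta(u)+\mathrm{Rem}^\dagger(s,F,m),$$ with $$|\mathrm{Rem}^\dagger(s,F,m)|\le\frac{(\gamma^\dagger_{m,\beta})^{s+1}}{2^{s+1}}\,\|F\|_{\mathcal C_b^{2s+2}}.$$ Moreover, for every $0<\varepsilon<1/2-\beta$ there is a constant $C$, depending only on $\beta$ and $\varepsilon$, such that $\gamma^\dagger_{m,\beta}\le C\,m^{-(1/2-\beta-\varepsilon)}$ for all $m\ge1$. -/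

import Mathlib

open MeasureTheory ProbabilityTheory Set
open scoped ENNReal NNReal InnerProductSpace lp

noncomputable section

namespace SteinExpansion

/-! ### The spaces `L²([0,1])` and `l²` -/

/-- Lebesgue measure on `[0,1]`. -/
abbrev unitVol : Measure ℝ := volume.restrict (Icc (0 : ℝ) 1)

/-- The Hilbert space `L²([0,1], dt)`. -/
abbrev L2 : Type := Lp ℝ 2 unitVol

/-- The Hilbert space `l²` of square summable real sequences. -/
abbrev l2 : Type := lp (fun _ : ℕ => ℝ) 2

/-- `l²` carries its Borel σ-algebra. -/
instance : MeasurableSpace l2 := borel l2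

instance : BorelSpace l2 := ⟨rfl⟩

/-- The canonical orthonormal basis `(x_n)` of `l²`. -/
def stdVec (n : ℕ) : l2 := lp.single 2 n (1 : ℝ)

/-! ### Fractional integrals and the isometry `J_β` -/

/-- The left fractional integral `I_{0+}^α f`; `I_{0+}^0` is the identity. -/
def fracIntLeft (α : ℝ) (f : ℝ → ℝ) (x : ℝ) : ℝ :=
  if α = 0 then f x
  else (Real.Gamma α)⁻¹ * ∫ t in (0 : ℝ)..x, f t * (x - t) ^ (α - 1)

/-- The right fractional integral `I_{1-}^α f`; `I_{1-}^0` is the identity. -/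
def fracIntRight (α : ℝ) (f : ℝ → ℝ) (x : ℝ) : ℝ :=
  if α = 0 then f x
  else (Real.Gamma α)⁻¹ * ∫ t in x..(1 : ℝ), f t * (t - x) ^ (α - 1)

open Classical in
/-- The fractional derivative `∂_β f`: the unique `g ∈ L²([0,1])` with `f = I_{0+}^β g` almost
everywhere on `[0,1]`, for `f` in the Besov-Liouville space `I_{0+}^β(L²)` (and `0` for `f`
outside this space). -/
def fracDeriv (β : ℝ) (f : ℝ → ℝ) : L2 :=
  if h : ∃ g : L2, f =ᵐ[unitVol] fracIntLeft β g then h.choose else 0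

/-- The map `J_β f = ∑_n (∫₀¹ ∂_β f(s) e_n(s) ds) x_n`, for a complete orthonormal basis `(e_n)` of
`L²([0,1])`. -/
def isoJ (β : ℝ) (e : HilbertBasis ℕ ℝ L2) (f : ℝ → ℝ) : l2 := e.repr (fracDeriv β f)

/-! ### Covariances -/

/-- `k_n^{1-β} = I_{1-}^{1-β} e_n`. -/
def kFun (β : ℝ) (e : HilbertBasis ℕ ℝ L2) (n : ℕ) : ℝ → ℝ := fracIntRight (1 - β) (e n)

/-- The matrix, in the basis `(x_n)`, of
`S_β = ∑_{n,l} (∫₀¹ k_n^{1-β}(s) k_l^{1-β}(s) ds) x_n ⊗ x_l`. -/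
def covLimit (β : ℝ) (e : HilbertBasis ℕ ℝ L2) (n l : ℕ) : ℝ :=
  ∫ s in (0 : ℝ)..1, kFun β e n s * kFun β e l s

/-- The functions `e^m_j = √m 1_{[j/m,(j+1)/m)}`, orthonormal in `L²([0,1])` for `j < m`. -/
def meshFun (m j : ℕ) : ℝ → ℝ :=
  (Ico ((j : ℝ) / m) (((j : ℝ) + 1) / m)).indicator fun _ => √(m : ℝ)

/-- The orthogonal projection in `L²([0,1])` onto the span of `e^m_0, …, e^m_{m-1}`. -/
def meshProj (m : ℕ) (f : ℝ → ℝ) (s : ℝ) : ℝ :=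
  ∑ j ∈ Finset.range m, (∫ t in (0 : ℝ)..1, f t * meshFun m j t) * meshFun m j s

/-- The matrix, in the basis `(x_n)`, of `S†_m = trace_{L²}(K†_m ⊗ K†_m)`, where
`K†_m = ∑_n (p_m k_n^{1-β}) ⊗ x_n` and `p_m` is the projection `meshProj m`. -/
def covMesh (β : ℝ) (e : HilbertBasis ℕ ℝ L2) (m n l : ℕ) : ℝ :=
  ∫ s in (0 : ℝ)..1, meshProj m (kFun β e n) s * meshProj m (kFun β e l) s

/-- The matrix of `S†_m - S_β`. -/
def covDiff (β : ℝ) (e : HilbertBasis ℕ ℝ L2) (m n l : ℕ) : ℝ :=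
  covMesh β e m n l - covLimit β e n l

/-- `γ†_{m,β}`: the trace `∑_n |⟨(S†_m - S_β) x_n, x_n⟩|` of the semi-definite operator
`S_β - S†_m`. -/
def gammaMesh (β : ℝ) (e : HilbertBasis ℕ ℝ L2) (m : ℕ) : ℝ := ∑' n, |covDiff β e m n n|

/-! ### The two measures -/

/-- The linear interpolation `b_m` of a path `b` on the mesh `1/m`: `b_m(0) = 0` and
`db_m(t) = m ∑_{i<m} (b((i+1)/m) - b(i/m)) 1_{[i/m,(i+1)/m)}(t) dt`. -/
def interp (m : ℕ) (b : ℝ≥0 → ℝ) (t : ℝ) : ℝ :=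
  ∫ r in (0 : ℝ)..t, (m : ℝ) * ∑ i ∈ Finset.range m,
    (b (((i : ℝ≥0) + 1) / m) - b ((i : ℝ≥0) / m)) *
      (Ico ((i : ℝ) / m) (((i : ℝ) + 1) / m)).indicator (fun _ => (1 : ℝ)) r

/-- `ν†_m`: the law on `l²` of `J_β B_m`, where `B_m` is the linear interpolation of `B`. -/
def lawMesh (β : ℝ) (e : HilbertBasis ℕ ℝ L2) (m : ℕ) {Ω : Type*} [MeasurableSpace Ω]
    (B : ℝ≥0 → Ω → ℝ) (P : Measure Ω) : Measure l2 :=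
  P.map fun ω => isoJ β e (interp m fun t => B t ω)

/-- `μ` is the centered Gaussian measure on `l²` whose covariance operator has the matrix `S` in
the basis `(x_n)`. -/
structure IsCenteredGaussian (μ : Measure l2) (S : ℕ → ℕ → ℝ) : Prop where
  gaussian : IsGaussian μ
  mean : ∀ n, ∫ x : l2, x n ∂μ = 0
  cov : ∀ n l, ∫ x : l2, x n * x l ∂μ = S n l

/-! ### Tensors and the spaces `C_b^k(l²; ℝ)` -/

/-- The coordinates of a `k`-linear form on `l²` in the orthonormal basis
`x_{n_1} ⊗ ⋯ ⊗ x_{n_k}` of `(l²)^{⊗k}`. -/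
def coord {k : ℕ} (A : ContinuousMultilinearMap ℝ (fun _ : Fin k => l2) ℝ) (n : Fin k → ℕ) : ℝ :=
  A fun i => stdVec (n i)

/-- The norm of `(l²)^{⊗k}` (Hilbert tensor product), infinite for a form that does not belong to
this space. -/
def tensorNorm {k : ℕ} (A : ContinuousMultilinearMap ℝ (fun _ : Fin k => l2) ℝ) : ℝ≥0∞ :=
  (∑' n : Fin k → ℕ, ‖coord A n‖ₑ ^ 2) ^ (1 / 2 : ℝ)

/-- `sup_{1 ≤ j ≤ k} sup_x ‖∇^{(j)} F(x)‖_{(l²)^{⊗j}}` with values in `[0,∞]`. -/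
def cbENorm (k : ℕ) (F : l2 → ℝ) : ℝ≥0∞ :=
  ⨆ j ∈ Finset.Icc 1 k, ⨆ x : l2, tensorNorm (iteratedFDeriv ℝ j F x)

/-- `F ∈ C_b^k(l²; ℝ)`: `F` is `k` times Fréchet differentiable and
`‖F‖_{C_b^k(l²; ℝ)} < ∞`. -/
structure MemCb (k : ℕ) (F : l2 → ℝ) : Prop where
  differentiable : ∀ j < k, Differentiable ℝ (iteratedFDeriv ℝ j F)
  bounded : cbENorm k F < ∞

/-- The norm `‖F‖_{C_b^k(l²; ℝ)}`. -/
def cbNorm (k : ℕ) (F : l2 → ℝ) : ℝ := (cbENorm k F).toReal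

/-- The coordinates of `T^{⊗j} ∈ (l²)^{⊗2j}`, for `T` with matrix `(T_{n,l})`. -/
def tensorPow (T : ℕ → ℕ → ℝ) (j : ℕ) (n : Fin (2 * j) → ℕ) : ℝ :=
  ∏ i : Fin j, T (n ⟨2 * i, by omega⟩) (n ⟨2 * i + 1, by omega⟩)

/-- The terms of the series that defines the scalar product `⟨A, T^{⊗j}⟩` of `(l²)^{⊗2j}`. -/
def pairingTerm {j : ℕ} (A : ContinuousMultilinearMap ℝ (fun _ : Fin (2 * j) => l2) ℝ)
    (T : ℕ → ℕ → ℝ) (n : Fin (2 * j) → ℕ) : ℝ :=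
  coord A n * tensorPow T j n

/-- The scalar product `⟨A, T^{⊗j}⟩` of `(l²)^{⊗2j}`. -/
def pairing {j : ℕ} (A : ContinuousMultilinearMap ℝ (fun _ : Fin (2 * j) => l2) ℝ)
    (T : ℕ → ℕ → ℝ) : ℝ :=
  ∑' n : Fin (2 * j) → ℕ, pairingTerm A T n

end SteinExpansion

end

open SteinExpansion

open MeasureTheory ProbabilityTheory Set
open scoped ENNReal NNReal InnerProductSpace lp

namespace SteinExpansion

/-! ### Gaussian integration by parts -/

/-! The law `ν` of the interpolated path is centered Gaussian with covariance `S†`, the Gram matrix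
of the projections `p_m k_n`. As `p_m` is an orthogonal projection, `D = S_β - S†` is positive
semidefinite, so `m_β` is the law of `X + Z` with `X` of law `ν` and `Z` an independent Gaussian of
covariance `D`. Along `t ↦ E F(X + √t Z)`, Gaussian integration by parts gives the heat equation:
each `t`-derivative contracts two more derivatives of `F` with `D/2`. Taylor's formula at `t = 1`,
where the law is `m_β`, evaluated at `t = 0`, where it is `ν`, yields the expansion; the signs
`(-1)^j` turn `D` into `S† - S_β`. The remainder is at most `2^{-(s+1)}` times the supremum of
`⟨∇^{(2s+2)}F, D^{⊗(s+1)}⟩`, which Cauchy–Schwarz bounds by the Hilbert–Schmidt norm of `D` to the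
power `s+1`, and that norm is at most the trace `γ†`.

The interpolation is carried out on the first `N` coordinates, where `D` is a finite sum of rank one
matrices and `Z` a finite combination of standard Gaussians (`hasDerivAt_smear`,
`expansion_truncPairing`, `map_prod_combo`). The bound is uniform in `N`, and
`expansion_of_isCenteredGaussian` lets `N` tend to infinity, using only weak `ℓ²` continuity of the
derivatives of `F`.

To identify `ν`, the fractional derivative of a piecewise linear path is computed explicitly; it is
well defined because `I_{0+}^β` is injective on `L²` (`fracIntLeft_injective`). Fractional
integration by parts then expresses its coefficients through integrals of `k_n` over the cells
(`isCenteredGaussian_lawMesh`).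

For the rate, `k_n(s)` is, up to a constant, the `n`-th coefficient of `(· - s)_+^{-β}`. Bessel's
inequality makes `s ↦ (k_n(s))_n` Hölder of exponent `1/2 - β` in `ℓ²`, and `γ†`, a sum of variances
of `k_n` over the cells, is `O(m^{-(1-2β)})` (`sum_abs_covDiff_le`). -/

theorem hasDerivAt_gaussianPDFReal (x : ℝ) :
    HasDerivAt (gaussianPDFReal 0 1) (-x * gaussianPDFReal 0 1 x) x := by
  have h1 : HasDerivAt (fun y : ℝ => -(y - 0) ^ 2 / (2 * ((1 : ℝ≥0) : ℝ))) (-x) x := by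
    have := (((hasDerivAt_id x).sub_const 0).pow 2).neg.div_const (2 * ((1 : ℝ≥0) : ℝ))
    refine this.congr_deriv ?_
    simp
    ring
  have h2 := h1.exp.const_mul (√(2 * Real.pi * ((1 : ℝ≥0) : ℝ)))⁻¹
  have h3 : gaussianPDFReal 0 1 = fun y : ℝ => (√(2 * Real.pi * ((1 : ℝ≥0) : ℝ)))⁻¹ *
      Real.exp (-(y - 0) ^ 2 / (2 * ((1 : ℝ≥0) : ℝ))) := by
    ext y; rw [gaussianPDFReal]
  rw [h3]
  refine h2.congr_deriv ?_
  ring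

theorem integrable_gaussianReal_iff {f : ℝ → ℝ} :
    Integrable f (gaussianReal 0 1) ↔ Integrable fun x => gaussianPDFReal 0 1 x * f x := by
  rw [gaussianReal_of_var_ne_zero _ one_ne_zero]
  rw [integrable_withDensity_iff_integrable_smul' (measurable_gaussianPDF 0 1)
    (ae_of_all _ fun _ => gaussianPDF_lt_top)]
  simp [toReal_gaussianPDF]

theorem integrable_gaussianReal_id : Integrable (fun x : ℝ => x) (gaussianReal 0 1) :=
  (memLp_id_gaussianReal 1).integrable le_rfl

/-- Stein's identity. The Gaussian density `φ` satisfies `φ' = -xφ`, so `φh' - xφh = (φh)'` has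
integral zero. Continuity of `h'` is not required, which later allows top-order derivatives of `F`.
-/
theorem integral_id_mul_gaussianReal {h h' : ℝ → ℝ} (hd : ∀ x, HasDerivAt h (h' x) x) {C : ℝ}
    (hC : ∀ x, |h x| ≤ C) (hC' : ∀ x, |h' x| ≤ C) :
    ∫ x, x * h x ∂gaussianReal 0 1 = ∫ x, h' x ∂gaussianReal 0 1 := by
  have hm : Measurable h := (continuous_iff_continuousAt.2 fun x => (hd x).continuousAt).measurable
  have hm' : Measurable h' := by
    have : h' = deriv h := funext fun x => (hd x).deriv.symm
    exact this ▸ measurable_deriv h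
  have i1 : Integrable h (gaussianReal 0 1) :=
    Integrable.of_bound hm.aestronglyMeasurable C (ae_of_all _ hC)
  have i2 : Integrable h' (gaussianReal 0 1) :=
    Integrable.of_bound hm'.aestronglyMeasurable C (ae_of_all _ hC')
  have i3 : Integrable (fun x => x * h x) (gaussianReal 0 1) :=
    integrable_gaussianReal_id.mul_bdd (c := C) hm.aestronglyMeasurable (ae_of_all _ hC)
  have hz : ∫ x, (gaussianPDFReal 0 1 x * h' x - gaussianPDFReal 0 1 x * (x * h x)) = 0 := by
    refine integral_eq_zero_of_hasDerivAt_of_integrable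
      (f := fun x => gaussianPDFReal 0 1 x * h x) (fun x => ?_) ?_ ?_
    · refine ((hasDerivAt_gaussianPDFReal x).mul (hd x)).congr_deriv ?_
      ring
    · exact (integrable_gaussianReal_iff.1 i2).sub (integrable_gaussianReal_iff.1 i3)
    · exact integrable_gaussianReal_iff.1 i1
  rw [integral_sub (integrable_gaussianReal_iff.1 i2) (integrable_gaussianReal_iff.1 i3)] at hz
  rw [integral_gaussianReal_eq_integral_smul one_ne_zero,
    integral_gaussianReal_eq_integral_smul one_ne_zero]
  simp only [smul_eq_mul]
  linarith

/-- The standard Gaussian measure on `ℝ^N`. -/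
noncomputable abbrev gaussPi (N : ℕ) : Measure (Fin N → ℝ) :=
  Measure.pi fun _ => gaussianReal 0 1

theorem integrable_gaussPi_eval {N : ℕ} (i : Fin N) :
    Integrable (fun ξ : Fin N → ℝ => ξ i) (gaussPi N) :=
  integrable_comp_eval (μ := fun _ : Fin N => gaussianReal 0 1) (i := i) integrable_gaussianReal_id

/-- Fubini isolates the `i`-th coordinate and reduces to the one-dimensional identity. -/
theorem integral_eval_mul_gaussPi {N : ℕ} (i : Fin N) {h h' : (Fin N → ℝ) → ℝ}
    (hm : Measurable h) (hm' : Measurable h')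
    (hd : ∀ ξ s, HasDerivAt (fun r => h (Function.update ξ i r)) (h' (Function.update ξ i s)) s)
    {C : ℝ} (hC : ∀ x, |h x| ≤ C) (hC' : ∀ x, |h' x| ≤ C) :
    ∫ ξ, ξ i * h ξ ∂gaussPi N = ∫ ξ, h' ξ ∂gaussPi N := by
  cases N with
  | zero => exact i.elim0
  | succ n =>
    have e := (measurePreserving_piFinSuccAbove (fun _ : Fin (n + 1) => gaussianReal 0 1) i).symm
    have i1 : Integrable (fun ξ : Fin (n + 1) → ℝ => ξ i * h ξ) (gaussPi (n + 1)) :=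
      (integrable_gaussPi_eval i).mul_bdd (c := C) hm.aestronglyMeasurable (ae_of_all _ hC)
    have i2 : Integrable h' (gaussPi (n + 1)) :=
      Integrable.of_bound hm'.aestronglyMeasurable C (ae_of_all _ hC')
    have j1 := e.integrable_comp_of_integrable i1
    have j2 := e.integrable_comp_of_integrable i2
    simp only [Function.comp_def] at j1 j2
    rw [← e.integral_comp', ← e.integral_comp', integral_prod_symm _ j1, integral_prod_symm _ j2]
    congr 1
    ext ζ
    have hupd : ∀ s r : ℝ, Function.update (i.insertNth (α := fun _ => ℝ) s ζ) i r =
        i.insertNth (α := fun _ => ℝ) r ζ := fun s r => by simp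
    have := integral_id_mul_gaussianReal (h := fun s => h (i.insertNth (α := fun _ => ℝ) s ζ))
      (h' := fun s => h' (i.insertNth (α := fun _ => ℝ) s ζ)) (fun s => ?_)
      (fun _ => hC _) (fun _ => hC' _)
    · simpa [MeasurableEquiv.piFinSuccAbove_symm_apply, Fin.insertNthEquiv] using this
    · simpa [hupd] using hd (i.insertNth (α := fun _ => ℝ) s ζ) s

/-! ### Gaussian interpolation -/

section Interpolation

variable {E : Type*} [NormedAddCommGroup E] [NormedSpace ℝ E]

/-- The linear map `ξ ↦ ∑ i, ξ i • q i`. -/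
noncomputable def combo {N : ℕ} (q : Fin N → E) : (Fin N → ℝ) →L[ℝ] E :=
  ∑ i, (ContinuousLinearMap.proj (R := ℝ) (φ := fun _ : Fin N => ℝ) i).smulRight (q i)

theorem combo_apply {N : ℕ} (q : Fin N → E) (ξ : Fin N → ℝ) : combo q ξ = ∑ i, ξ i • q i := by
  simp [combo]

theorem combo_update {N : ℕ} (q : Fin N → E) (ξ : Fin N → ℝ) (i : Fin N) (r s : ℝ) :
    combo q (Function.update ξ i r) = combo q (Function.update ξ i s) + (r - s) • q i := by
  have : Function.update ξ i r = Function.update ξ i s + (r - s) • Pi.single i 1 := by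
    ext j
    rcases eq_or_ne j i with rfl | h
    · simp
    · simp [h]
  rw [this, map_add, map_smul]
  congr 2
  simp [combo_apply, Pi.single_apply]

variable [MeasurableSpace E] [BorelSpace E] [SecondCountableTopology E]

omit [MeasurableSpace E] [BorelSpace E] [SecondCountableTopology E] in
theorem integrable_norm_combo {N : ℕ} (q : Fin N → E) :
    Integrable (fun ξ => ‖combo q ξ‖) (gaussPi N) := by
  simp only [combo_apply]
  refine (integrable_finsetSum _ fun i _ => ?_).norm
  exact (integrable_gaussPi_eval i).smul_const _

/-- The mean of `G (X + √t ∑ ξ_i q_i)`, for `X` of law `μ` and independent standard Gaussian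
`ξ_i`. -/
noncomputable def smear {N : ℕ} (μ : Measure E) (q : Fin N → E) (G : E → ℝ) (t : ℝ) : ℝ :=
  ∫ z, G (z.1 + √t • combo q z.2) ∂(μ.prod (gaussPi N))

variable {N : ℕ} {μ : Measure E} [IsProbabilityMeasure μ] {q : Fin N → E} {G : E → ℝ}
  {G' : E → E →L[ℝ] ℝ} {C : ℝ}

omit [MeasurableSpace E] [BorelSpace E] [SecondCountableTopology E] in
theorem abs_le_of_fderiv_bound (hG : ∀ x, HasFDerivAt G (G' x) x) (hC : ∀ x, ‖G' x‖ ≤ C) (x : E) :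
    |G x| ≤ |G 0| + C * ‖x‖ := by
  have := Convex.norm_image_sub_le_of_norm_hasFDerivWithin_le (f := G) (f' := G') (s := univ)
    (C := C) (x := 0) (y := x) (fun x _ => (hG x).hasFDerivWithinAt) (fun x _ => hC x)
    convex_univ trivial trivial
  rw [sub_zero, Real.norm_eq_abs] at this
  have h2 := abs_sub_abs_le_abs_sub (G x) (G 0)
  linarith

omit [BorelSpace E] [SecondCountableTopology E] in
theorem integrable_prod_norms (hμ : Integrable (fun x => ‖x‖) μ) :
    Integrable (fun z : E × (Fin N → ℝ) => ‖z.1‖ + ‖combo q z.2‖) (μ.prod (gaussPi N)) :=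
  (hμ.comp_fst _).add ((integrable_norm_combo q).comp_snd _)

-- Continuity up to `t = 0` has to be proved separately, since `√t` is not differentiable there. A
-- bounded gradient gives linear growth, hence an integrable majorant.
omit [SecondCountableTopology E] in
theorem continuousOn_smear (hμ : Integrable (fun x => ‖x‖) μ)
    (hG : ∀ x, HasFDerivAt G (G' x) x) (hC : ∀ x, ‖G' x‖ ≤ C) :
    ContinuousOn (smear μ q G) (Icc 0 1) := by
  have hGc : Continuous G := continuous_iff_continuousAt.2 fun x => (hG x).continuousAt
  have hC0 : 0 ≤ C := (norm_nonneg _).trans (hC 0)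
  refine continuousOn_of_dominated
    (bound := fun z => |G 0| + C * (‖z.1‖ + ‖combo q z.2‖)) ?_ ?_ ?_ ?_
  · intro t _
    exact (hGc.comp (by fun_prop)).measurable.aestronglyMeasurable
  · intro t ht
    refine ae_of_all _ fun z => (abs_le_of_fderiv_bound hG hC _).trans ?_
    gcongr
    refine (norm_add_le _ _).trans ?_
    gcongr
    rw [norm_smul, Real.norm_of_nonneg (Real.sqrt_nonneg t)]
    exact mul_le_of_le_one_left (norm_nonneg _) (Real.sqrt_le_one.2 ht.2)
  · exact (integrable_const _).add ((integrable_prod_norms hμ).const_mul _)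
  · exact ae_of_all _ fun z => (hGc.comp (by fun_prop)).continuousOn

/-- The heat equation. Differentiating `√t` produces `1/(2√t)` times the mean of `∑ ξ_i G'(·)(q_i)`;
integration by parts in each `ξ_i` produces a factor `√t` which cancels the singularity. The second
derivatives enter only along the directions `q_i`, and only as bounded measurable functions. -/
theorem hasDerivAt_smear (hμ : Integrable (fun x => ‖x‖) μ)
    (hG : ∀ x, HasFDerivAt G (G' x) x) (hC : ∀ x, ‖G' x‖ ≤ C)
    (hGm : ∀ v, Measurable fun x => G' x v) {G2 : Fin N → E → ℝ}
    (hG2 : ∀ i x, HasDerivAt (fun r : ℝ => G' (x + r • q i) (q i)) (G2 i x) 0) {C2 : ℝ}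
    (hC2 : ∀ i x, |G2 i x| ≤ C2) (hG2m : ∀ i, Measurable (G2 i)) {t : ℝ} (ht : 0 < t) :
    HasDerivAt (smear μ q G) (1 / 2 * smear μ q (fun x => ∑ i, G2 i x) t) t := by
  have hGc : Continuous G := continuous_iff_continuousAt.2 fun x => (hG x).continuousAt
  have hC0 : 0 ≤ C := (norm_nonneg _).trans (hC 0)
  have hst : 0 < √t := Real.sqrt_pos.2 ht
  set ρ := μ.prod (gaussPi N) with hρ
  have hmeas : ∀ s : ℝ, Measurable fun z : E × (Fin N → ℝ) => z.1 + √s • combo q z.2 :=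
    fun s => by fun_prop
  have hexp : ∀ (s : ℝ) (z : E × (Fin N → ℝ)), G' (z.1 + √s • combo q z.2) (combo q z.2) =
      ∑ i, z.2 i * G' (z.1 + √s • combo q z.2) (q i) := by
    intro s z
    conv_lhs => rw [combo_apply q z.2]
    simp [combo_apply]
  -- On `s > t/2` the factor `1/(2√s)` stays below its value at `t/2`, which gives the majorant.
  have key := hasDerivAt_integral_of_dominated_loc_of_deriv_le (μ := ρ) (x₀ := t)
    (F := fun s z => G (z.1 + √s • combo q z.2))
    (F' := fun s z => 1 / (2 * √s) * G' (z.1 + √s • combo q z.2) (combo q z.2))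
    (bound := fun z => 1 / (2 * √(t / 2)) * (C * ‖combo q z.2‖)) (s := Ioi (t / 2))
    (Ioi_mem_nhds (by linarith)) ?_ ?_ ?_ ?_ ?_ ?_
  · refine key.2.congr_deriv ?_
    have hint : ∀ i, Integrable
        (fun z : E × (Fin N → ℝ) => z.2 i * G' (z.1 + √t • combo q z.2) (q i)) ρ := by
      intro i
      refine ((integrable_gaussPi_eval i).comp_snd μ).mul_bdd (c := C * ‖q i‖)
        (((hGm (q i)).comp (hmeas t)).aestronglyMeasurable) (ae_of_all _ fun z => ?_)
      exact (G' _).le_of_opNorm_le (hC _) _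
    have hint2 : ∀ i, Integrable (fun z : E × (Fin N → ℝ) => G2 i (z.1 + √t • combo q z.2)) ρ :=
      fun i => Integrable.of_bound ((hG2m i).comp (hmeas t)).aestronglyMeasurable C2
        (ae_of_all _ fun z => hC2 i _)
    have hstein : ∀ i, ∫ z, z.2 i * G' (z.1 + √t • combo q z.2) (q i) ∂ρ =
        √t * ∫ z, G2 i (z.1 + √t • combo q z.2) ∂ρ := by
      intro i
      rw [hρ, integral_prod _ (hint i), integral_prod _ (hint2 i), ← integral_const_mul]
      congr 1
      ext x
      rw [← integral_const_mul]
      refine integral_eval_mul_gaussPi i (h := fun ξ => G' (x + √t • combo q ξ) (q i))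
        (h' := fun ξ => √t * G2 i (x + √t • combo q ξ))
        (C := max (C * ‖q i‖) (√t * C2)) ((hGm (q i)).comp (by fun_prop))
        (((hG2m i).comp (by fun_prop)).const_mul _) ?_ ?_ ?_
      · intro ξ s
        have h1 := hG2 i (x + √t • combo q (Function.update ξ i s))
        have h2 : HasDerivAt (fun r : ℝ => √t * (r - s)) (√t) s := by
          simpa using ((hasDerivAt_id s).sub_const s).const_mul (√t)
        have h3 := HasDerivAt.comp_of_eq (h₂ := fun r : ℝ =>
          G' (x + √t • combo q (Function.update ξ i s) + r • q i) (q i)) s h1 h2 (by simp)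
        rw [mul_comm]
        refine h3.congr_of_eventuallyEq (Filter.Eventually.of_forall fun r => ?_)
        simp only [Function.comp]
        rw [combo_update q ξ i r s, smul_add, smul_smul, add_assoc]
      · exact fun ξ => ((G' _).le_of_opNorm_le (hC _) _).trans (le_max_left _ _)
      · intro ξ
        rw [abs_mul, abs_of_pos hst]
        exact (mul_le_mul_of_nonneg_left (hC2 i _) hst.le).trans (le_max_right _ _)
    rw [integral_const_mul]
    simp only [hexp]
    rw [integral_finsetSum _ fun i _ => hint i, smear, ← hρ,
      integral_finsetSum _ fun i _ => hint2 i]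
    simp only [hstein]
    rw [← Finset.mul_sum]
    field_simp
  · exact Filter.Eventually.of_forall fun s => (hGc.measurable.comp (hmeas s)).aestronglyMeasurable
  · refine Integrable.mono' (g := fun z => |G 0| + C * (‖z.1‖ + √t * ‖combo q z.2‖))
      ((integrable_const _).add (((hμ.comp_fst _).add
        (((integrable_norm_combo q).comp_snd _).const_mul _)).const_mul _))
      (hGc.measurable.comp (hmeas t)).aestronglyMeasurable (ae_of_all _ fun z => ?_)
    refine (abs_le_of_fderiv_bound hG hC _).trans ?_
    gcongr
    refine (norm_add_le _ _).trans ?_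
    rw [norm_smul, Real.norm_of_nonneg (Real.sqrt_nonneg t)]
  · simp only [hexp]
    refine Measurable.aestronglyMeasurable (Measurable.const_mul ?_ _)
    refine Finset.measurable_fun_sum _ fun i _ => Measurable.mul (by fun_prop) ?_
    exact (hGm (q i)).comp (hmeas t)
  · refine ae_of_all _ fun z s hs => ?_
    have hs' : t / 2 < s := hs
    have hs0 : 0 < s := by linarith
    rw [norm_mul, Real.norm_of_nonneg (by positivity)]
    gcongr
    exact (G' _).le_of_opNorm_le (hC _) _
  · exact (((integrable_norm_combo q).comp_snd _).const_mul _).const_mul _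
  · refine ae_of_all _ fun z s hs => ?_
    have hs' : t / 2 < s := hs
    have hs0 : s ≠ 0 := by linarith
    have h1 : HasDerivAt (fun s : ℝ => z.1 + √s • combo q z.2)
        ((1 / (2 * √s)) • combo q z.2) s :=
      ((Real.hasDerivAt_sqrt hs0).smul_const _).const_add _
    refine ((hG _).comp_hasDerivAt s h1).congr_deriv ?_
    simp

end Interpolation

/-- A crude form of Taylor's formula. -/
theorem abs_sub_taylor_le (s : ℕ) (f : ℕ → ℝ → ℝ) {M : ℝ}
    (hc : ∀ j < s, ContinuousOn (f j) (Icc 0 1))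
    (hd : ∀ j < s, ∀ t ∈ Ioo (0 : ℝ) 1, HasDerivAt (f j) (f (j + 1) t) t)
    (hM : ∀ t ∈ Icc (0 : ℝ) 1, |f s t| ≤ M) :
    ∀ t ∈ Icc (0 : ℝ) 1,
      |f 0 t - ∑ j ∈ Finset.range s, (t - 1) ^ j / j.factorial * f j 1| ≤ M := by
  induction s generalizing f with
  | zero => simpa using hM
  | succ s ih =>
    intro t ht
    have ih' := ih (fun j => f (j + 1)) (fun j hj => hc _ (by omega))
      (fun j hj => hd _ (by omega)) hM
    -- The remainder `g` vanishes at `1`, and its derivative is the remainder one order lower for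
    -- the shifted family. The mean value theorem on `[t, 1]`, of length at most `1`, preserves the
    -- bound `M`; the factorial gain is given up.
    set g : ℝ → ℝ := fun t => f 0 t - ∑ j ∈ Finset.range (s + 1), (t - 1) ^ j / j.factorial * f j 1
      with hg
    have hg1 : g 1 = 0 := by
      simp only [hg, sub_self, Finset.sum_range_succ']
      simp
    have hgc : ContinuousOn g (Icc 0 1) := (hc 0 (by omega)).sub (by fun_prop)
    have hgd : ∀ t ∈ Ioo (0 : ℝ) 1, HasDerivAt g
        (f 1 t - ∑ j ∈ Finset.range s, (t - 1) ^ j / j.factorial * f (j + 1) 1) t := by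
      intro t ht
      refine (hd 0 (by omega) t ht).sub ?_
      have : ∀ j ∈ Finset.range s, HasDerivAt
          (fun t : ℝ => (t - 1) ^ (j + 1) / ((j + 1).factorial : ℝ) * f (j + 1) 1)
          ((t - 1) ^ j / j.factorial * f (j + 1) 1) t := by
        intro j _
        have h1 := ((((hasDerivAt_id t).sub_const 1).pow (j + 1)).div_const
          ((j + 1).factorial : ℝ)).mul_const (f (j + 1) 1)
        refine h1.congr_deriv ?_
        rw [Nat.factorial_succ]
        push_cast
        simp only [id]
        have : (j.factorial : ℝ) ≠ 0 := by positivity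
        field_simp
      have h2 := (HasDerivAt.fun_sum this).add_const (f 0 1)
      simp only [Finset.sum_range_succ']
      simpa using h2
    rcases ht.2.eq_or_lt with rfl | ht1
    · change |g 1| ≤ M
      rw [hg1, abs_zero]
      exact (abs_nonneg _).trans (hM 1 (by simp))
    · obtain ⟨c, hc', hceq⟩ := exists_hasDerivAt_eq_slope g _ ht1
        (hgc.mono (Icc_subset_Icc_left ht.1)) (fun x hx => hgd x ⟨ht.1.trans_lt hx.1, hx.2⟩)
      have hb := ih' c ⟨ht.1.trans hc'.1.le, hc'.2.le⟩
      simp only [zero_add] at hb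
      rw [hceq, hg1, zero_sub, abs_div, abs_neg, abs_of_pos (sub_pos.2 ht1),
        div_le_iff₀ (sub_pos.2 ht1)] at hb
      refine hb.trans ?_
      have hM0 : 0 ≤ M := (abs_nonneg _).trans (hM 1 (by simp))
      nlinarith [ht.1]

/-! ### Coordinates in `l²` -/

/-- The `n`-th coordinate, as a continuous linear form. -/
noncomputable abbrev coordCLM (n : ℕ) : l2 →L[ℝ] ℝ := lp.evalCLM ℝ (fun _ : ℕ => ℝ) 2 n

theorem coordCLM_apply (n : ℕ) (x : l2) : coordCLM n x = x n := rfl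

/-- The orthogonal projection onto the span of the first `N` basis vectors. -/
noncomputable def projN (N : ℕ) : l2 →L[ℝ] l2 :=
  ∑ n ∈ Finset.range N, (coordCLM n).smulRight (stdVec n)

theorem smul_stdVec (c : ℝ) (n : ℕ) : c • stdVec n = lp.single 2 n c := by
  rw [stdVec, ← lp.single_smul, smul_eq_mul, mul_one]

theorem projN_apply (N : ℕ) (x : l2) : projN N x = ∑ n ∈ Finset.range N, x n • stdVec n := by
  simp [projN, coordCLM_apply]

theorem tendsto_projN (x : l2) : Filter.Tendsto (fun N => projN N x) Filter.atTop (nhds x) := by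
  have := (lp.hasSum_single (p := 2) (by simp) x).tendsto_sum_nat
  simpa only [projN_apply, smul_stdVec] using this

theorem norm_projN_sq (N : ℕ) (x : l2) : ‖projN N x‖ ^ 2 = ∑ n ∈ Finset.range N, x n ^ 2 := by
  have := lp.norm_sum_single (p := 2) (by simp) (fun n => x n) (Finset.range N)
  simp only [projN_apply, smul_stdVec]
  simpa using this

theorem sum_sq_le_norm_sq (x : l2) (N : ℕ) : ∑ n ∈ Finset.range N, x n ^ 2 ≤ ‖x‖ ^ 2 := by
  have := lp.sum_rpow_le_norm_rpow (p := 2) (by simp) x (Finset.range N)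
  simpa using this

theorem norm_projN_le (N : ℕ) (x : l2) : ‖projN N x‖ ≤ ‖x‖ := by
  have := sum_sq_le_norm_sq x N
  rw [← norm_projN_sq] at this
  exact (sq_le_sq₀ (norm_nonneg _) (norm_nonneg _)).1 this

/-- Separability makes sums of `l2`-valued measurable maps measurable. -/
instance : SecondCountableTopology l2 := by
  have h1 : TopologicalSpace.IsSeparable (univ : Set l2) := by
    have h2 : TopologicalSpace.IsSeparable (Submodule.span ℝ (range stdVec) : Set l2) :=
      (countable_range stdVec).isSeparable.span
    refine h2.closure.mono fun x _ => ?_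
    refine mem_closure_of_tendsto (tendsto_projN x) (Filter.Eventually.of_forall fun N => ?_)
    rw [projN_apply]
    exact Submodule.sum_mem _ fun n _ => Submodule.smul_mem _ _ (Submodule.subset_span ⟨n, rfl⟩)
  have := TopologicalSpace.isSeparable_univ_iff.1 h1
  exact UniformSpace.secondCountable_of_separable l2

theorem abs_sum_mul_le {ι : Type*} (S : Finset ι) (f g : ι → ℝ) {A B : ℝ} (hA : 0 ≤ A) (hB : 0 ≤ B)
    (hf : ∑ i ∈ S, f i ^ 2 ≤ A ^ 2) (hg : ∑ i ∈ S, g i ^ 2 ≤ B ^ 2) :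
    |∑ i ∈ S, f i * g i| ≤ A * B := by
  refine abs_le_of_sq_le_sq ?_ (by positivity)
  calc (∑ i ∈ S, f i * g i) ^ 2 ≤ (∑ i ∈ S, f i ^ 2) * ∑ i ∈ S, g i ^ 2 :=
        Finset.sum_mul_sq_le_sq_mul_sq _ _ _
    _ ≤ A ^ 2 * B ^ 2 := by gcongr
    _ = (A * B) ^ 2 := by ring

theorem norm_le_of_sum_sq_le (L : l2 →L[ℝ] ℝ) {M : ℝ} (hM : 0 ≤ M)
    (h : ∀ N, ∑ a ∈ Finset.range N, L (stdVec a) ^ 2 ≤ M ^ 2) : ‖L‖ ≤ M := by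
  refine L.opNorm_le_bound hM fun x => ?_
  refine le_of_tendsto ((L.continuous.tendsto x).comp (tendsto_projN x)).norm
    (Filter.Eventually.of_forall fun N => ?_)
  simp only [Function.comp, projN_apply, map_sum, map_smul, smul_eq_mul, Real.norm_eq_abs]
  rw [mul_comm M]
  exact abs_sum_mul_le _ _ _ (norm_nonneg x) hM (sum_sq_le_norm_sq x N) (h N)

/-! ### Tensors -/

/-- The multi-indices with entries below `N`. -/
def box (k N : ℕ) : Finset (Fin k → ℕ) := Fintype.piFinset fun _ => Finset.range N

theorem mem_box {k N : ℕ} {n : Fin k → ℕ} : n ∈ box k N ↔ ∀ i, n i < N := by simp [box]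

theorem sum_box_succ {k N : ℕ} (f : (Fin (k + 1) → ℕ) → ℝ) :
    ∑ n ∈ box (k + 1) N, f n = ∑ a ∈ Finset.range N, ∑ n ∈ box k N, f (Fin.cons a n) := by
  rw [← Finset.sum_product']
  refine Finset.sum_nbij' (fun n => (n 0, Fin.tail n)) (fun p => Fin.cons p.1 p.2) ?_ ?_ ?_ ?_ ?_
  · intro n hn
    simp only [mem_box, Finset.mem_product, Finset.mem_range] at hn ⊢
    exact ⟨hn 0, fun i => hn i.succ⟩
  · rintro ⟨a, n⟩ hn
    simp only [mem_box, Finset.mem_product, Finset.mem_range] at hn ⊢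
    intro i
    refine Fin.cases ?_ (fun i => ?_) i
    · simpa using hn.1
    · simpa using hn.2 i
  · intro n _; simp
  · rintro ⟨a, n⟩ _; simp
  · intro n _; simp

theorem exists_subset_box {k : ℕ} (S : Finset (Fin k → ℕ)) : ∃ N₀, ∀ N ≥ N₀, S ⊆ box k N := by
  refine ⟨S.sup (fun n => Finset.univ.sup n) + 1, fun N hN n hn => mem_box.2 fun i => ?_⟩
  have h1 : n i ≤ Finset.univ.sup n := Finset.le_sup (f := n) (Finset.mem_univ i)
  have h2 : Finset.univ.sup n ≤ S.sup fun n => Finset.univ.sup n :=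
    Finset.le_sup (f := fun n : Fin k → ℕ => Finset.univ.sup n) hn
  omega

theorem tensorPow_succ (T : ℕ → ℕ → ℝ) (j a b : ℕ) (n : Fin (2 * j) → ℕ) :
    tensorPow T (j + 1) (Fin.cons (n := 2 * j + 1) (α := fun _ => ℕ) a
      (Fin.cons (α := fun _ => ℕ) b n)) = T a b * tensorPow T j n := by
  unfold tensorPow
  rw [Fin.prod_univ_succ]
  rfl

/-- Hilbert–Schmidt norms multiply under tensor products; on a box the identity is exact, peeling
off one pair of indices at a time. -/
theorem sum_box_tensorPow_sq (T : ℕ → ℕ → ℝ) (j N : ℕ) :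
    ∑ n ∈ box (2 * j) N, tensorPow T j n ^ 2 =
      (∑ a ∈ Finset.range N, ∑ b ∈ Finset.range N, T a b ^ 2) ^ j := by
  induction j with
  | zero =>
    simp [tensorPow, box]
  | succ j ih =>
    have h1 := sum_box_succ (k := 2 * j + 1) (N := N) fun n => tensorPow T (j + 1) n ^ 2
    refine h1.trans ?_
    simp only [sum_box_succ (k := 2 * j), tensorPow_succ, mul_pow, ← Finset.mul_sum, ih,
      ← Finset.sum_mul]
    ring

theorem tensorPow_neg (T : ℕ → ℕ → ℝ) (j : ℕ) (n : Fin (2 * j) → ℕ) :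
    tensorPow (fun a b => -T a b) j n = (-1) ^ j * tensorPow T j n := by
  simp [tensorPow, Finset.prod_neg]

/-- The Hilbert-Schmidt norm of `T` is at most `g`. -/
def HSBound (T : ℕ → ℕ → ℝ) (g : ℝ) : Prop :=
  ∀ N, ∑ a ∈ Finset.range N, ∑ b ∈ Finset.range N, T a b ^ 2 ≤ g ^ 2

theorem HSBound.sum_tensorPow_sq_le {T : ℕ → ℕ → ℝ} {g : ℝ} (h : HSBound T g) (j : ℕ)
    (S : Finset (Fin (2 * j) → ℕ)) : ∑ n ∈ S, tensorPow T j n ^ 2 ≤ (g ^ j) ^ 2 := by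
  obtain ⟨N, hN⟩ := exists_subset_box S
  refine (Finset.sum_le_sum_of_subset_of_nonneg (hN N le_rfl) fun _ _ _ => sq_nonneg _).trans ?_
  rw [sum_box_tensorPow_sq, ← pow_mul, mul_comm j, pow_mul]
  exact pow_le_pow_left₀ (Finset.sum_nonneg fun _ _ => Finset.sum_nonneg fun _ _ => sq_nonneg _)
    (h N) j

/-- Brings the `ℝ≥0∞`-valued norm down to finite real sums of squares, the only form in which it is
used afterwards. -/
theorem sum_coord_sq_le {k : ℕ} {A : ContinuousMultilinearMap ℝ (fun _ : Fin k => l2) ℝ}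
    {M : ℝ} (hM : 0 ≤ M) (hA : tensorNorm A ≤ ENNReal.ofReal M) (S : Finset (Fin k → ℕ)) :
    ∑ n ∈ S, coord A n ^ 2 ≤ M ^ 2 := by
  have h1 : (∑' n : Fin k → ℕ, ‖coord A n‖ₑ ^ 2) ≤ ENNReal.ofReal M ^ 2 := by
    have := ENNReal.rpow_le_rpow hA (z := 2) (by norm_num)
    rw [tensorNorm, ← ENNReal.rpow_mul] at this
    norm_num at this
    exact this
  have h2 : ∑ n ∈ S, ENNReal.ofReal (coord A n ^ 2) ≤ ENNReal.ofReal (M ^ 2) := by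
    refine le_trans ?_ ((ENNReal.sum_le_tsum S).trans (h1.trans ?_))
    · refine Finset.sum_le_sum fun n _ => ?_
      rw [Real.enorm_eq_ofReal_abs, ← ENNReal.ofReal_pow (abs_nonneg _), sq_abs]
    · rw [ENNReal.ofReal_pow hM]
  rw [← ENNReal.ofReal_sum_of_nonneg fun _ _ => sq_nonneg _] at h2
  exact (ENNReal.ofReal_le_ofReal_iff (sq_nonneg M)).1 h2

theorem MemCb.tensorNorm_le {k : ℕ} {F : l2 → ℝ} (hF : MemCb k F) {j : ℕ} (h1 : 1 ≤ j)
    (hj : j ≤ k) (x : l2) : tensorNorm (iteratedFDeriv ℝ j F x) ≤ ENNReal.ofReal (cbNorm k F) := by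
  rw [cbNorm, ENNReal.ofReal_toReal hF.bounded.ne]
  exact (le_iSup (fun x => tensorNorm (iteratedFDeriv ℝ j F x)) x).trans
    (le_iSup₂ (f := fun j (_ : j ∈ Finset.Icc 1 k) => ⨆ x : l2, tensorNorm (iteratedFDeriv ℝ j F x))
      j (Finset.mem_Icc.2 ⟨h1, hj⟩))

theorem cbNorm_nonneg (k : ℕ) (F : l2 → ℝ) : 0 ≤ cbNorm k F := ENNReal.toReal_nonneg

theorem MemCb.sum_coord_sq_le {k : ℕ} {F : l2 → ℝ} (hF : MemCb k F) {j : ℕ} (h1 : 1 ≤ j)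
    (hj : j ≤ k) (x : l2) (S : Finset (Fin j → ℕ)) :
    ∑ n ∈ S, coord (iteratedFDeriv ℝ j F x) n ^ 2 ≤ cbNorm k F ^ 2 :=
  SteinExpansion.sum_coord_sq_le (cbNorm_nonneg k F) (hF.tensorNorm_le h1 hj x) S

theorem MemCb.abs_coord_le {k : ℕ} {F : l2 → ℝ} (hF : MemCb k F) {j : ℕ} (h1 : 1 ≤ j)
    (hj : j ≤ k) (x : l2) (n : Fin j → ℕ) :
    |coord (iteratedFDeriv ℝ j F x) n| ≤ cbNorm k F := by
  have := hF.sum_coord_sq_le h1 hj x {n}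
  rw [Finset.sum_singleton] at this
  exact abs_le_of_sq_le_sq this (cbNorm_nonneg _ _)

/-- The partial sum of the pairing over the multi-indices with entries below `N`. -/
noncomputable def truncPairing (N : ℕ) {j : ℕ}
    (A : ContinuousMultilinearMap ℝ (fun _ : Fin (2 * j) => l2) ℝ) (T : ℕ → ℕ → ℝ) : ℝ :=
  ∑ n ∈ box (2 * j) N, pairingTerm A T n

/-! ### Cauchy–Schwarz bounds and weak continuity of the pairing -/

section Pairing

variable {j : ℕ} {A : ContinuousMultilinearMap ℝ (fun _ : Fin (2 * j) => l2) ℝ}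
  {T : ℕ → ℕ → ℝ} {M g : ℝ}

theorem abs_truncPairing_le (hM : 0 ≤ M) (hg : 0 ≤ g) (hT : HSBound T g)
    (hA : ∀ S : Finset (Fin (2 * j) → ℕ), ∑ n ∈ S, coord A n ^ 2 ≤ M ^ 2) (N : ℕ) :
    |truncPairing N A T| ≤ M * g ^ j :=
  abs_sum_mul_le _ _ _ hM (by positivity) (hA _) (hT.sum_tensorPow_sq_le j _)

theorem summable_mul_of_sum_sq_le {ι : Type*} {f h : ι → ℝ} {A B : ℝ}
    (hf : ∀ S : Finset ι, ∑ i ∈ S, f i ^ 2 ≤ A) (hh : ∀ S : Finset ι, ∑ i ∈ S, h i ^ 2 ≤ B) :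
    Summable fun i => f i * h i := by
  have h1 : Summable fun i => f i ^ 2 := summable_of_sum_le (fun _ => sq_nonneg _) hf
  have h2 : Summable fun i => h i ^ 2 := summable_of_sum_le (fun _ => sq_nonneg _) hh
  refine (h1.add h2).of_norm_bounded fun i => ?_
  rw [Real.norm_eq_abs, abs_mul]
  nlinarith [sq_nonneg (|f i| - |h i|), sq_abs (f i), sq_abs (h i), sq_nonneg (f i),
    sq_nonneg (h i)]

/-- Weak convergence in `ℓ²`: bounded sequences which converge coordinatewise. -/
theorem tendsto_sum_mul_of_bounded {ι : Type*} {I : ℕ → Finset ι}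
    (hI : ∀ S : Finset ι, ∃ N₀, ∀ N ≥ N₀, S ⊆ I N) {a : ℕ → ι → ℝ} {b h : ι → ℝ} {M B : ℝ}
    (hM : 0 ≤ M)
    (ha : ∀ N, ∀ S : Finset ι, ∑ i ∈ S, a N i ^ 2 ≤ M ^ 2)
    (hb : ∀ S : Finset ι, ∑ i ∈ S, b i ^ 2 ≤ M ^ 2)
    (hh : ∀ S : Finset ι, ∑ i ∈ S, h i ^ 2 ≤ B)
    (hab : ∀ i, Filter.Tendsto (fun N => a N i) Filter.atTop (nhds (b i))) :
    Filter.Tendsto (fun N => ∑ i ∈ I N, a N i * h i) Filter.atTop (nhds (∑' i, b i * h i)) := by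
  classical
  have h2 : Summable fun i => h i ^ 2 := summable_of_sum_le (fun _ => sq_nonneg _) hh
  have hs : Summable fun i => b i * h i := summable_mul_of_sum_sq_le hb hh
  rw [Metric.tendsto_atTop]
  intro ε hε
  -- Chosen so that `M * δ < ε / 3`, also when `M = 0`. Off a finite set `S` the tail of `h` is
  -- below `δ`, so both tails cost at most `M * δ` by Cauchy–Schwarz; on `S` coordinatewise
  -- convergence suffices.
  set δ := ε / (4 * (M + 1)) with hδ
  have hδ0 : 0 < δ := by positivity
  obtain ⟨S, hS⟩ := summable_iff_vanishing_norm.1 h2 (δ ^ 2) (by positivity)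
  have hS' : ∀ R : Finset ι, Disjoint R S → ∑ i ∈ R, h i ^ 2 ≤ δ ^ 2 := fun R hR =>
    (le_abs_self _).trans (hS R hR).le
  have hMδ : M * δ < ε / 3 := by
    have h3 : M * δ ≤ ε / 4 := by
      rw [hδ, mul_div_assoc', div_le_div_iff₀ (by positivity) (by norm_num)]
      nlinarith
    linarith
  obtain ⟨N₀, hN₀⟩ := hI S
  have hlim : Filter.Tendsto (fun N => ∑ i ∈ S, a N i * h i) Filter.atTop
      (nhds (∑ i ∈ S, b i * h i)) := tendsto_finsetSum _ fun i _ => (hab i).mul_const _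
  obtain ⟨N₁, hN₁⟩ := Metric.tendsto_atTop.1 hlim (ε / 3) (by positivity)
  have htail : |∑ i ∈ S, b i * h i - ∑' i, b i * h i| ≤ M * δ := by
    refine le_of_tendsto ((tendsto_const_nhds.sub hs.hasSum).abs) ?_
    filter_upwards [Filter.eventually_ge_atTop S] with R hR
    rw [← Finset.sum_sdiff hR, abs_sub_comm, add_sub_cancel_right]
    exact abs_sum_mul_le _ _ _ hM hδ0.le (hb _) (hS' _ Finset.sdiff_disjoint)
  refine ⟨max N₀ N₁, fun N hN => ?_⟩
  have h4 := hN₁ N (le_of_max_le_right hN)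
  have h5 : |∑ i ∈ I N \ S, a N i * h i| ≤ M * δ :=
    abs_sum_mul_le _ _ _ hM hδ0.le (ha N _) (hS' _ Finset.sdiff_disjoint)
  rw [Real.dist_eq] at h4 ⊢
  rw [← Finset.sum_sdiff (hN₀ N (le_of_max_le_left hN))]
  rw [abs_lt] at *
  rw [abs_le] at *
  constructor <;> linarith [h4.1, h4.2, h5.1, h5.2, htail.1, htail.2]

end Pairing

/-! ### Derivatives of pairings -/

section Derivatives

variable {F : l2 → ℝ} {k : ℕ}

theorem differentiable_iteratedFDeriv_apply (hd : Differentiable ℝ (iteratedFDeriv ℝ k F))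
    (m : Fin k → l2) : Differentiable ℝ fun u => iteratedFDeriv ℝ k F u m := fun u =>
  ((hd u).hasFDerivAt.continuousMultilinear_apply_const m).differentiableAt

theorem fderiv_iteratedFDeriv_apply (hd : Differentiable ℝ (iteratedFDeriv ℝ k F))
    (m : Fin k → l2) (u v : l2) :
    fderiv ℝ (fun u => iteratedFDeriv ℝ k F u m) u v =
      iteratedFDeriv ℝ (k + 1) F u (Fin.cons v m) := by
  rw [((hd u).hasFDerivAt.continuousMultilinear_apply_const m).fderiv,
    iteratedFDeriv_succ_apply_left]
  simp

/-- The derivative of highest order need not be continuous, but it is measurable because it is the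
derivative of a function. -/
theorem measurable_iteratedFDeriv_succ_apply (hd : Differentiable ℝ (iteratedFDeriv ℝ k F))
    (m : Fin (k + 1) → l2) : Measurable fun u => iteratedFDeriv ℝ (k + 1) F u m := by
  have := measurable_fderiv_apply_const ℝ (fun u => iteratedFDeriv ℝ k F u (Fin.tail m)) (m 0)
  simpa only [fderiv_iteratedFDeriv_apply hd, Fin.cons_self_tail] using this

theorem coord_cons (A : ContinuousMultilinearMap ℝ (fun _ : Fin (k + 1) => l2) ℝ) (a : ℕ)
    (n : Fin k → ℕ) :
    A (Fin.cons (stdVec a) fun i => stdVec (n i)) = coord A (Fin.cons a n) := by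
  unfold coord
  congr 1
  ext1 i
  refine Fin.cases ?_ (fun i => ?_) i <;> simp

theorem apply_cons_sum (A : ContinuousMultilinearMap ℝ (fun _ : Fin (k + 1) => l2) ℝ) (N : ℕ)
    (c : ℕ → ℝ) (m : Fin k → l2) :
    A (Fin.cons (∑ a ∈ Finset.range N, c a • stdVec a) m) =
      ∑ a ∈ Finset.range N, c a * A (Fin.cons (stdVec a) m) := by
  have h : ∀ v, A (Fin.cons v m) = (A.curryLeft v) m := fun v => by simp
  simp only [h, map_sum, map_smul, sum_apply, smul_apply, smul_eq_mul]

end Derivatives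

/-! ### The expansion for truncated pairings -/

section TruncatedExpansion

variable {F : l2 → ℝ} {K j N : ℕ} {T : ℕ → ℕ → ℝ}

/-- The basis tensor `x_{n_1} ⊗ ⋯ ⊗ x_{n_k}` as a family of vectors. -/
noncomputable abbrev basisFam {k : ℕ} (n : Fin k → ℕ) : Fin k → l2 := fun i => stdVec (n i)

theorem MemCb.differentiable_apply (hF : MemCb K F) {k : ℕ} (hk : k < K) (m : Fin k → l2) :
    Differentiable ℝ fun u => iteratedFDeriv ℝ k F u m :=
  differentiable_iteratedFDeriv_apply (hF.differentiable k hk) m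

theorem hasFDerivAt_truncPairing (hF : MemCb K F) (hj : 2 * j < K) (u : l2) :
    HasFDerivAt (fun u => truncPairing N (iteratedFDeriv ℝ (2 * j) F u) T)
      (∑ n ∈ box (2 * j) N, tensorPow T j n •
        fderiv ℝ (fun u => iteratedFDeriv ℝ (2 * j) F u (basisFam n)) u) u := by
  unfold truncPairing pairingTerm
  refine HasFDerivAt.fun_sum fun n _ => ?_
  exact ((hF.differentiable_apply hj _ u).hasFDerivAt).mul_const _

/-- The coordinates of this gradient form one slice of the tensor of order `k + 1`, so its norm is
at most the Hilbert–Schmidt norm of that tensor. -/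
theorem MemCb.norm_fderiv_apply_le (hF : MemCb K F) {k : ℕ} (hk : k + 1 ≤ K) (n : Fin k → ℕ)
    (u : l2) : ‖fderiv ℝ (fun u => iteratedFDeriv ℝ k F u (basisFam n)) u‖ ≤ cbNorm K F := by
  refine norm_le_of_sum_sq_le _ (cbNorm_nonneg _ _) fun N => ?_
  simp only [fderiv_iteratedFDeriv_apply (hF.differentiable k hk), coord_cons]
  have hinj : Function.Injective fun a : ℕ => (Fin.cons a n : Fin (k + 1) → ℕ) := fun a b h => by
    simpa using congrFun h 0
  have := hF.sum_coord_sq_le (by omega) hk u ((Finset.range N).map ⟨_, hinj⟩)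
  rwa [Finset.sum_map] at this

theorem norm_fderiv_truncPairing_le (hF : MemCb K F) (hj : 2 * j < K) (u : l2) :
    ‖∑ n ∈ box (2 * j) N, tensorPow T j n •
        fderiv ℝ (fun u => iteratedFDeriv ℝ (2 * j) F u (basisFam n)) u‖ ≤
      ∑ n ∈ box (2 * j) N, |tensorPow T j n| * cbNorm K F := by
  refine (norm_sum_le _ _).trans (Finset.sum_le_sum fun n _ => ?_)
  rw [norm_smul, Real.norm_eq_abs]
  exact mul_le_mul_of_nonneg_left (hF.norm_fderiv_apply_le hj n u) (abs_nonneg _)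

theorem MemCb.measurable_coord_succ (hF : MemCb K F) {k : ℕ} (hk : k < K) (m : Fin (k + 1) → l2) :
    Measurable fun u => iteratedFDeriv ℝ (k + 1) F u m :=
  measurable_iteratedFDeriv_succ_apply (hF.differentiable k hk) m

theorem truncPairing_succ (A : ContinuousMultilinearMap ℝ (fun _ : Fin (2 * (j + 1)) => l2) ℝ) :
    truncPairing N A T = ∑ a ∈ Finset.range N, ∑ b ∈ Finset.range N, ∑ n ∈ box (2 * j) N,
      coord (k := 2 * j + 1 + 1) A (Fin.cons a (Fin.cons b n)) * (T a b * tensorPow T j n) := by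
  have h := sum_box_succ (k := 2 * j + 1) (N := N) fun n => pairingTerm A T n
  refine h.trans ?_
  simp only [sum_box_succ (k := 2 * j)]
  refine Finset.sum_congr rfl fun a _ => Finset.sum_congr rfl fun b _ =>
    Finset.sum_congr rfl fun n _ => ?_
  rw [← tensorPow_succ]
  rfl

/-- If `T = ∑ c_i c_iᵀ`, then the second derivatives along the directions `q_i = ∑ c_i(a) x_a` add
up to the contraction with `T`. -/
theorem sum_apply_cons_cons {d k : ℕ}
    (A : ContinuousMultilinearMap ℝ (fun _ : Fin (k + 1 + 1) => l2) ℝ)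
    {c : Fin d → ℕ → ℝ} (hc : ∀ a < N, ∀ b < N, ∑ i, c i a * c i b = T a b) (n : Fin k → ℕ) :
    ∑ i, A (Fin.cons (∑ a ∈ Finset.range N, c i a • stdVec a)
        (Fin.cons (∑ a ∈ Finset.range N, c i a • stdVec a) (basisFam n))) =
      ∑ a ∈ Finset.range N, ∑ b ∈ Finset.range N, coord A (Fin.cons a (Fin.cons b n)) * T a b := by
  have h1 : ∀ (v w : l2) (m : Fin k → l2), A (Fin.cons v (Fin.cons w m)) =
      (A.curryLeft v) (Fin.cons w m) := fun v w m => by simp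
  have h2 : ∀ a b, A (Fin.cons (stdVec a) (Fin.cons (stdVec b) (basisFam n))) =
      coord A (Fin.cons a (Fin.cons b n)) := by
    intro a b
    rw [← coord_cons]
    congr 2
    ext1 i
    refine Fin.cases ?_ (fun i => ?_) i <;> simp
  simp only [apply_cons_sum]
  simp only [h1, apply_cons_sum]
  simp only [← h1, h2, Finset.mul_sum]
  rw [Finset.sum_comm]
  refine Finset.sum_congr rfl fun a ha => ?_
  rw [Finset.sum_comm]
  refine Finset.sum_congr rfl fun b hb => ?_
  rw [← hc a (Finset.mem_range.1 ha) b (Finset.mem_range.1 hb), Finset.mul_sum]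
  exact Finset.sum_congr rfl fun i _ => by ring

theorem abs_apply_cons_cons_le (hF : MemCb K F) {k : ℕ} (hk : k + 2 ≤ K) (c : ℕ → ℝ) 
    (n : Fin k → ℕ) (u : l2) :
    |iteratedFDeriv ℝ (k + 1 + 1) F u (Fin.cons (∑ a ∈ Finset.range N, c a • stdVec a)
        (Fin.cons (∑ a ∈ Finset.range N, c a • stdVec a) (basisFam n)))| ≤
      ∑ a ∈ Finset.range N, ∑ b ∈ Finset.range N, cbNorm K F * |c a * c b| := by
  have := sum_apply_cons_cons (d := 1) (N := N) (iteratedFDeriv ℝ (k + 1 + 1) F u) (c := fun _ => c)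
    (T := fun a b => c a * c b) (by simp) n
  rw [Finset.univ_unique, Finset.sum_singleton] at this
  rw [this]
  refine (Finset.abs_sum_le_sum_abs _ _).trans (Finset.sum_le_sum fun a _ => ?_)
  refine (Finset.abs_sum_le_sum_abs _ _).trans (Finset.sum_le_sum fun b _ => ?_)
  rw [abs_mul]
  exact mul_le_mul_of_nonneg_right (hF.abs_coord_le (by omega) hk u _) (abs_nonneg _)

variable {μ : Measure l2} [IsProbabilityMeasure μ]

/-- The heat equation sends the pairing with `T^{⊗j}` to half the pairing with `T^{⊗(j+1)}`, so the
family indexed by `j` is stable under differentiation in `t`. The case `2 * j + 2 = K` is included: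
there the new tensor is only measurable and bounded in its coordinates. -/
theorem hasDerivAt_smear_truncPairing (hμ : Integrable (fun x => ‖x‖) μ) (hF : MemCb K F)
    (hj : 2 * j + 2 ≤ K) {d : ℕ} {c : Fin d → ℕ → ℝ}
    (hc : ∀ a < N, ∀ b < N, ∑ i, c i a * c i b = T a b) {t : ℝ} (ht : 0 < t) :
    HasDerivAt (smear μ (fun i => ∑ a ∈ Finset.range N, c i a • stdVec a)
        fun u => truncPairing N (iteratedFDeriv ℝ (2 * j) F u) T)
      (1 / 2 * smear μ (fun i => ∑ a ∈ Finset.range N, c i a • stdVec a)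
        (fun u => truncPairing N (iteratedFDeriv ℝ (2 * (j + 1)) F u) T) t) t := by
  set q : Fin d → l2 := fun i => ∑ a ∈ Finset.range N, c i a • stdVec a with hq
  set G2 : Fin d → l2 → ℝ := fun i u => ∑ n ∈ box (2 * j) N, tensorPow T j n *
    iteratedFDeriv ℝ (2 * j + 1 + 1) F u (Fin.cons (q i) (Fin.cons (q i) (basisFam n))) with hG2
  have hsum : (fun u => truncPairing N (iteratedFDeriv ℝ (2 * (j + 1)) F u) T) =
      fun u => ∑ i, G2 i u := by
    ext u
    have h : ∀ n : Fin (2 * j) → ℕ, ∑ i, tensorPow T j n * iteratedFDeriv ℝ (2 * j + 1 + 1) F u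
        (Fin.cons (q i) (Fin.cons (q i) (basisFam n))) = tensorPow T j n *
        ∑ a ∈ Finset.range N, ∑ b ∈ Finset.range N,
          coord (iteratedFDeriv ℝ (2 * j + 1 + 1) F u) (Fin.cons a (Fin.cons b n)) * T a b :=
      fun n => by rw [← Finset.mul_sum, sum_apply_cons_cons _ hc]
    simp only [truncPairing_succ, hG2]
    rw [Finset.sum_comm (s := Finset.univ)]
    simp only [h, Finset.mul_sum]
    symm
    rw [Finset.sum_comm]
    refine Finset.sum_congr rfl fun a _ => ?_
    rw [Finset.sum_comm]
    exact Finset.sum_congr rfl fun b _ => Finset.sum_congr rfl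
      fun n _ => (mul_comm _ _).trans (mul_assoc _ _ _)
  rw [hsum]
  have hGv : ∀ u v, (∑ n ∈ box (2 * j) N, tensorPow T j n •
        fderiv ℝ (fun u => iteratedFDeriv ℝ (2 * j) F u (basisFam n)) u) v =
      ∑ n ∈ box (2 * j) N, tensorPow T j n *
        iteratedFDeriv ℝ (2 * j + 1) F u (Fin.cons v (basisFam n)) := by
    intro u v
    simp [fderiv_iteratedFDeriv_apply (hF.differentiable (2 * j) (by omega))]
  refine hasDerivAt_smear hμ (fun u => hasFDerivAt_truncPairing hF (by omega) u)
    (fun u => norm_fderiv_truncPairing_le hF (by omega) u) (fun v => ?_) (fun i u => ?_)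
    (C2 := ∑ n ∈ box (2 * j) N, |tensorPow T j n| *
      ∑ i, ∑ a ∈ Finset.range N, ∑ b ∈ Finset.range N, cbNorm K F * |c i a * c i b|)
    (fun i u => ?_) (fun i => ?_) ht
  · simp only [hGv]
    exact Finset.measurable_fun_sum _ fun n _ =>
      (hF.measurable_coord_succ (by omega) _).const_mul _
  · simp only [hGv, hG2]
    refine HasDerivAt.fun_sum fun n _ => HasDerivAt.const_mul _ ?_
    have h1 : HasDerivAt (fun r : ℝ => u + r • q i) (q i) 0 := by
      simpa using ((hasDerivAt_id (0 : ℝ)).smul_const (q i)).const_add u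
    have h2 := (hF.differentiable_apply (k := 2 * j + 1) (by omega)
      (Fin.cons (q i) (basisFam n)) u).hasFDerivAt
    have h3 := HasFDerivAt.comp_hasDerivAt_of_eq (0 : ℝ) h2 h1 (by simp)
    refine h3.congr_deriv ?_
    rw [fderiv_iteratedFDeriv_apply (hF.differentiable (2 * j + 1) (by omega))]
  · refine (Finset.abs_sum_le_sum_abs _ _).trans (Finset.sum_le_sum fun n _ => ?_)
    rw [abs_mul]
    refine mul_le_mul_of_nonneg_left ?_ (abs_nonneg _)
    refine (abs_apply_cons_cons_le hF (by omega) (c i) n u).trans ?_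
    exact Finset.single_le_sum (f := fun i => ∑ a ∈ Finset.range N, ∑ b ∈ Finset.range N,
      cbNorm K F * |c i a * c i b|) (fun i _ => Finset.sum_nonneg fun a _ =>
        Finset.sum_nonneg fun b _ => mul_nonneg (cbNorm_nonneg _ _) (abs_nonneg _))
      (Finset.mem_univ i)
  · exact Finset.measurable_fun_sum _ fun n _ =>
      (hF.measurable_coord_succ (by omega) _).const_mul _

theorem truncPairing_zero (u : l2) : truncPairing N (iteratedFDeriv ℝ (2 * 0) F u) T = F u := by
  simp [truncPairing, pairingTerm, tensorPow, coord, box]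

/-- `abs_sub_taylor_le` applied to `2^{-j}` times the smeared pairings. The expansion point is `t =
1`, the evaluation point `t = 0`, whence the sign `(-1)^j = (0 - 1)^j`. -/
theorem expansion_truncPairing (hμ : Integrable (fun x => ‖x‖) μ) {s : ℕ}
    (hF : MemCb (2 * s + 2) F) {d : ℕ} {c : Fin d → ℕ → ℝ}
    (hc : ∀ a < N, ∀ b < N, ∑ i, c i a * c i b = T a b) {M : ℝ}
    (hM : ∀ u, |truncPairing N (iteratedFDeriv ℝ (2 * (s + 1)) F u) T| ≤ M) :
    |∫ u, F u ∂μ - ∑ j ∈ Finset.range (s + 1), (-1) ^ j / (2 ^ j * (j.factorial : ℝ)) *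
        ∫ z : l2 × (Fin d → ℝ), truncPairing N (iteratedFDeriv ℝ (2 * j) F
          (z.1 + combo (fun i => ∑ a ∈ Finset.range N, c i a • stdVec a) z.2)) T
            ∂(μ.prod (gaussPi d))| ≤ M / 2 ^ (s + 1) := by
  set q : Fin d → l2 := fun i => ∑ a ∈ Finset.range N, c i a • stdVec a with hq
  set f : ℕ → ℝ → ℝ := fun j t => (1 / 2) ^ j * smear μ q
    (fun u => truncPairing N (iteratedFDeriv ℝ (2 * j) F u) T) t with hf
  have key := abs_sub_taylor_le (s + 1) f (M := M / 2 ^ (s + 1)) ?_ ?_ ?_ 0 (by simp)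
  · have h0 : f 0 0 = ∫ u, F u ∂μ := by
      have := integral_fun_fst (μ := μ) (ν := gaussPi d) F
      simp only [hf, smear, truncPairing_zero]
      simpa using this
    rw [h0] at key
    convert key using 4 with j
    simp only [hf, smear, zero_sub, Real.sqrt_one, one_smul]
    rw [one_div, inv_pow]
    ring
  · intro j hj
    exact (continuousOn_smear hμ (fun u => hasFDerivAt_truncPairing hF (by omega) u)
      (fun u => norm_fderiv_truncPairing_le hF (by omega) u)).const_smul ((1 / 2 : ℝ) ^ j)
  · intro j hj t ht
    refine ((hasDerivAt_smear_truncPairing hμ hF (by omega) hc ht.1).const_mul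
      ((1 / 2 : ℝ) ^ j)).congr_deriv ?_
    simp only [hf]
    ring
  · intro t _
    simp only [hf, abs_mul, smear]
    rw [abs_of_pos (by positivity), one_div, inv_pow, inv_mul_eq_div]
    gcongr
    have := norm_integral_le_of_norm_le_const (μ := μ.prod (gaussPi d)) (C := M)
      (f := fun z => truncPairing N (iteratedFDeriv ℝ (2 * (s + 1)) F (z.1 + √t • combo q z.2)) T)
      (ae_of_all _ fun z => hM _)
    simpa using this

end TruncatedExpansion

/-! ### Gaussian laws on `l²` -/

instance isGaussian_gaussPi (d : ℕ) : IsGaussian (gaussPi d) := by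
  have h := map_pi_eq_stdGaussian (ι := Fin d)
  have h2 : gaussPi d = (stdGaussian (EuclideanSpace ℝ (Fin d))).map
      (EuclideanSpace.equiv (Fin d) ℝ) := by
    rw [← h, Measure.map_map (by fun_prop) (by fun_prop)]
    exact Measure.map_id.symm
  rw [h2]
  infer_instance

theorem apply_combo {d : ℕ} (q : Fin d → l2) (L : l2 →L[ℝ] ℝ) (ξ : Fin d → ℝ) :
    L (combo q ξ) = ∑ i, ξ i * L (q i) := by
  simp [combo_apply]

theorem integral_combo {d : ℕ} (q : Fin d → l2) (L : l2 →L[ℝ] ℝ) :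
    ∫ ξ, L (combo q ξ) ∂gaussPi d = 0 := by
  simp only [apply_combo]
  rw [integral_finsetSum _ fun i _ => (integrable_gaussPi_eval i).mul_const _]
  refine Finset.sum_eq_zero fun i _ => ?_
  rw [integral_mul_const, integral_comp_eval (μ := fun _ : Fin d => gaussianReal 0 1)
    (f := fun x => x) (by fun_prop), integral_id_gaussianReal, zero_mul]

theorem variance_combo {d : ℕ} (q : Fin d → l2) (L : l2 →L[ℝ] ℝ) :
    Var[fun ξ => L (combo q ξ); gaussPi d] = ∑ i, L (q i) ^ 2 := by
  have h1 : (fun ξ => L (combo q ξ)) = ∑ i, fun ξ : Fin d → ℝ => L (q i) * ξ i := by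
    ext ξ
    simp [combo_apply, mul_comm]
  rw [h1, variance_sum_pi]
  · change ∑ i, Var[fun x ↦ _ * (id x); gaussianReal 0 1] = _
    simp_rw [variance_const_mul, variance_id_gaussianReal]
    simp
  · exact fun i ↦ IsGaussian.memLp_two_id.const_mul _

section Centered

variable {μ ν : Measure l2} {S S' : ℕ → ℕ → ℝ}

theorem IsCenteredGaussian.integrable_mul (h : IsCenteredGaussian μ S) (n l : ℕ) :
    Integrable (fun x : l2 => x n * x l) μ := by
  have := h.gaussian
  exact (IsGaussian.memLp_dual μ (coordCLM n) 2 (by simp)).integrable_mul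
    (IsGaussian.memLp_dual μ (coordCLM l) 2 (by simp))

theorem apply_projN (L : l2 →L[ℝ] ℝ) (N : ℕ) (x : l2) :
    L (projN N x) = ∑ n ∈ Finset.range N, x n * L (stdVec n) := by
  simp [projN_apply]

theorem IsCenteredGaussian.integral_apply_projN (h : IsCenteredGaussian μ S) (L : l2 →L[ℝ] ℝ)
    (N : ℕ) : ∫ x, L (projN N x) ∂μ = 0 := by
  have := h.gaussian
  have hi : ∀ n, Integrable (fun x : l2 => x n * L (stdVec n)) μ := fun n =>
    (IsGaussian.integrable_dual μ (coordCLM n)).mul_const _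
  simp only [apply_projN]
  rw [integral_finsetSum _ fun n _ => hi n]
  refine Finset.sum_eq_zero fun n _ => ?_
  rw [integral_mul_const, h.mean, zero_mul]

theorem IsCenteredGaussian.variance_apply_projN (h : IsCenteredGaussian μ S) (L : l2 →L[ℝ] ℝ)
    (N : ℕ) : Var[fun x => L (projN N x); μ] =
      ∑ a ∈ Finset.range N, ∑ b ∈ Finset.range N, L (stdVec a) * L (stdVec b) * S a b := by
  have := h.gaussian
  rw [variance_of_integral_eq_zero (by fun_prop) (h.integral_apply_projN L N)]
  have h1 : ∀ x : l2, L (projN N x) ^ 2 = ∑ a ∈ Finset.range N, ∑ b ∈ Finset.range N,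
      L (stdVec a) * L (stdVec b) * (x a * x b) := by
    intro x
    rw [apply_projN, sq, Finset.sum_mul_sum]
    exact Finset.sum_congr rfl fun a _ => Finset.sum_congr rfl fun b _ => by ring
  simp only [h1]
  rw [integral_finsetSum _ fun a _ => integrable_finsetSum _ fun b _ =>
    (h.integrable_mul a b).const_mul _]
  refine Finset.sum_congr rfl fun a _ => ?_
  rw [integral_finsetSum _ fun b _ => (h.integrable_mul a b).const_mul _]
  refine Finset.sum_congr rfl fun b _ => ?_
  rw [integral_const_mul, h.cov]

/-- Provides the finitely many directions needed to realise a Gaussian vector of covariance `T`, cut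
at `N`, as `∑ ξ_i q_i`. -/
theorem exists_factorization {T : ℕ → ℕ → ℝ} (hsymm : ∀ a b, T a b = T b a) (N : ℕ)
    (hpos : ∀ v : ℕ → ℝ, 0 ≤ ∑ a ∈ Finset.range N, ∑ b ∈ Finset.range N, v a * v b * T a b) :
    ∃ (d : ℕ) (c : Fin d → ℕ → ℝ), ∀ a < N, ∀ b < N, ∑ i, c i a * c i b = T a b := by
  have hM : (Matrix.of fun a b : Fin N => T a b).PosSemidef := by
    refine Matrix.PosSemidef.of_dotProduct_mulVec_nonneg ?_ fun v => ?_
    · ext a b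
      simp [hsymm (a : ℕ) b]
    · have := hpos fun a => if h : a < N then v ⟨a, h⟩ else 0
      simp only [Finset.sum_range, Fin.is_lt, dite_true, Fin.eta] at this
      refine this.trans_eq ?_
      simp only [dotProduct, Matrix.mulVec, Finset.mul_sum, Matrix.of_apply, star_trivial]
      exact Finset.sum_congr rfl fun a _ => Finset.sum_congr rfl fun b _ => by ring
  obtain ⟨d, v, hv⟩ := Matrix.posSemidef_iff_eq_sum_vecMulVec.1 hM
  refine ⟨d, fun i a => if h : a < N then v i ⟨a, h⟩ else 0, fun a ha b hb => ?_⟩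
  have := congrFun (congrFun hv ⟨a, ha⟩) ⟨b, hb⟩
  simp only [ha, hb, dite_true]
  simpa [Matrix.sum_apply, Matrix.vecMulVec_apply] using this.symm

/-- Both sides are centered Gaussian, hence determined by the variances of linear forms. Variances
add under independence, and the added part has covariance `S - S'`. -/
theorem map_prod_combo (hν : IsCenteredGaussian ν S') (hμ : IsCenteredGaussian μ S) {N d : ℕ}
    {c : Fin d → ℕ → ℝ} (hc : ∀ a < N, ∀ b < N, ∑ i, c i a * c i b = S a b - S' a b) :
    ((ν.map (projN N)).prod (gaussPi d)).map
      (fun z => z.1 + combo (fun i => ∑ a ∈ Finset.range N, c i a • stdVec a) z.2) =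
      μ.map (projN N) := by
  have := hν.gaussian
  have := hμ.gaussian
  set q : Fin d → l2 := fun i => ∑ a ∈ Finset.range N, c i a • stdVec a with hq
  set Φ : l2 × (Fin d → ℝ) →L[ℝ] l2 := ContinuousLinearMap.fst ℝ _ _ +
    (combo q).comp (ContinuousLinearMap.snd ℝ _ _) with hΦ
  change ((ν.map (projN N)).prod (gaussPi d)).map Φ = μ.map (projN N)
  refine Measure.ext_of_charFunDual (funext fun L => ?_)
  have i1 : Integrable (fun x => L x) (ν.map (projN N)) := IsGaussian.integrable_dual _ L
  have i2 : Integrable (fun ξ => L (combo q ξ)) (gaussPi d) :=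
    IsGaussian.integrable_dual _ (L.comp (combo q))
  rw [charFunDual_map, IsGaussian.charFunDual_eq, IsGaussian.charFunDual_eq]
  have m1 : ∫ x, (L.comp Φ) x ∂((ν.map (projN N)).prod (gaussPi d)) = 0 := by
    have : ∀ z, (L.comp Φ) z = L z.1 + L (combo q z.2) := fun z => by simp [hΦ]
    simp only [this]
    rw [integral_add (i1.comp_fst _) (i2.comp_snd _), integral_fun_fst (fun x => L x),
      integral_fun_snd (fun ξ => L (combo q ξ)),
      integral_combo, integral_map (by fun_prop) (by fun_prop),
      hν.integral_apply_projN]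
    simp
  have m2 : ∫ x, L x ∂(μ.map (projN N)) = 0 := by
    rw [integral_map (by fun_prop) (by fun_prop), hμ.integral_apply_projN]
  have v1 : Var[L.comp Φ; (ν.map (projN N)).prod (gaussPi d)] = Var[L; μ.map (projN N)] := by
    rw [variance_dual_prod (IsGaussian.memLp_id _ 2 (by simp)) (IsGaussian.memLp_id _ 2 (by simp))]
    have e1 : ((L.comp Φ).comp (.inl ℝ l2 (Fin d → ℝ)) : l2 → ℝ) = L := by ext x; simp [hΦ]
    have e2 : ((L.comp Φ).comp (.inr ℝ l2 (Fin d → ℝ)) : (Fin d → ℝ) → ℝ) =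
      fun ξ => L (combo q ξ) := by ext x; simp [hΦ]
    rw [e1, e2, variance_combo, variance_map (by fun_prop) (by fun_prop),
      variance_map (by fun_prop) (by fun_prop)]
    have h1 := hν.variance_apply_projN L N
    have h2 := hμ.variance_apply_projN L N
    simp only [Function.comp_def, h1, h2]
    have h3 : ∀ i, L (q i) ^ 2 = ∑ a ∈ Finset.range N, ∑ b ∈ Finset.range N,
        L (stdVec a) * L (stdVec b) * (c i a * c i b) := by
      intro i
      simp only [hq, map_sum, map_smul, smul_eq_mul, sq, Finset.sum_mul_sum]
      exact Finset.sum_congr rfl fun a _ => Finset.sum_congr rfl fun b _ => by ring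
    simp only [h3]
    rw [Finset.sum_comm (s := Finset.univ), ← Finset.sum_add_distrib]
    refine Finset.sum_congr rfl fun a ha => ?_
    rw [Finset.sum_comm (s := Finset.univ), ← Finset.sum_add_distrib]
    refine Finset.sum_congr rfl fun b hb => ?_
    rw [← Finset.mul_sum, hc a (Finset.mem_range.1 ha) b (Finset.mem_range.1 hb)]
    ring
  rw [v1]
  simp only [integral_complex_ofReal, m1, m2]

end Centered

/-! ### The expansion -/

section Expansion

variable {F : l2 → ℝ} {K j : ℕ} {T : ℕ → ℕ → ℝ} {g : ℝ}

theorem MemCb.hasFDerivAt (hF : MemCb K F) (hK : 0 < K) (u : l2) :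
    HasFDerivAt F (fderiv ℝ F u) u := by
  have := hF.differentiable_apply hK (basisFam (k := 0) Fin.elim0) u
  simp only [iteratedFDeriv_zero_apply] at this
  exact this.hasFDerivAt

theorem MemCb.norm_fderiv_le (hF : MemCb K F) (hK : 0 < K) (u : l2) :
    ‖fderiv ℝ F u‖ ≤ cbNorm K F := by
  have := hF.norm_fderiv_apply_le (k := 0) hK Fin.elim0 u
  simpa only [iteratedFDeriv_zero_apply] using this

theorem MemCb.continuous (hF : MemCb K F) (hK : 0 < K) : Continuous F :=
  continuous_iff_continuousAt.2 fun u => (hF.hasFDerivAt hK u).continuousAt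

theorem MemCb.abs_le (hF : MemCb K F) (hK : 0 < K) (u : l2) :
    |F u| ≤ |F 0| + cbNorm K F * ‖u‖ :=
  abs_le_of_fderiv_bound (hF.hasFDerivAt hK) (hF.norm_fderiv_le hK) u

theorem MemCb.integrable (hF : MemCb K F) (hK : 0 < K) (μ : Measure l2) [IsGaussian μ] :
    Integrable F μ :=
  ((integrable_const _).add ((IsGaussian.integrable_id (μ := μ)).norm.const_mul _)).mono'
    (hF.continuous hK).aestronglyMeasurable (ae_of_all _ fun u => hF.abs_le hK u)

theorem pairing_zero (u : l2) : pairing (iteratedFDeriv ℝ (2 * 0) F u) T = F u := by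
  have : Unique (Fin (2 * 0) → ℕ) := inferInstanceAs (Unique (Fin 0 → ℕ))
  rw [pairing, (hasSum_unique _).tsum_eq]
  simp [pairingTerm, tensorPow, coord]

theorem summable_pairingTerm (hF : MemCb K F) (hT : HSBound T g) (hj : 2 * j ≤ K) (u : l2) :
    Summable (pairingTerm (iteratedFDeriv ℝ (2 * j) F u) T) := by
  rcases Nat.eq_zero_or_pos j with rfl | hj0
  · have : Unique (Fin (2 * 0) → ℕ) := inferInstanceAs (Unique (Fin 0 → ℕ))
    exact (hasSum_unique _).summable
  · exact summable_mul_of_sum_sq_le (hF.sum_coord_sq_le (by omega) hj u) (hT.sum_tensorPow_sq_le j)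

theorem continuous_truncPairing (hF : MemCb K F) (hj : 2 * j < K) (N : ℕ) :
    Continuous fun u => truncPairing N (iteratedFDeriv ℝ (2 * j) F u) T :=
  continuous_iff_continuousAt.2 fun u => (hasFDerivAt_truncPairing hF hj u).continuousAt

theorem MemCb.abs_truncPairing_le (hF : MemCb K F) (hg : 0 ≤ g) (hT : HSBound T g) (hj0 : 1 ≤ j)
    (hj : 2 * j ≤ K) (N : ℕ) (u : l2) :
    |truncPairing N (iteratedFDeriv ℝ (2 * j) F u) T| ≤ cbNorm K F * g ^ j :=
  SteinExpansion.abs_truncPairing_le (cbNorm_nonneg _ _) hg hT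
    (hF.sum_coord_sq_le (by omega) hj u) N

/-- Differentiability controls `∇^{(2j)}F` in operator norm, not in Hilbert–Schmidt norm. Its
coordinates are nevertheless continuous and its Hilbert–Schmidt norm is bounded, which is weak
convergence in `ℓ²` and suffices against the fixed tensor `T^{⊗j}`. -/
theorem tendsto_truncPairing (hF : MemCb K F) (hT : HSBound T g) (hj0 : 1 ≤ j)
    (hj : 2 * j < K) {w : ℕ → l2} {u : l2} (hw : Filter.Tendsto w Filter.atTop (nhds u)) :
    Filter.Tendsto (fun N => truncPairing N (iteratedFDeriv ℝ (2 * j) F (w N)) T) Filter.atTop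
      (nhds (pairing (iteratedFDeriv ℝ (2 * j) F u) T)) := by
  refine tendsto_sum_mul_of_bounded exists_subset_box (cbNorm_nonneg K F)
    (fun N => hF.sum_coord_sq_le (by omega) hj.le (w N))
    (hF.sum_coord_sq_le (by omega) hj.le u) (hT.sum_tensorPow_sq_le j) fun n => ?_
  exact ((hF.differentiable_apply hj (basisFam n)).continuous.tendsto u).comp hw

theorem integrable_pairing (hF : MemCb K F) (hg : 0 ≤ g) (hT : HSBound T g)
    (hj : 2 * j < K) (μ : Measure l2) [IsGaussian μ] :
    Integrable (fun u => pairing (iteratedFDeriv ℝ (2 * j) F u) T) μ := by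
  -- `cbNorm` starts at order one, so `F` itself is not bounded: the case `j = 0` relies on linear
  -- growth and Gaussian first moments.
  rcases Nat.eq_zero_or_pos j with rfl | hj0
  · simp only [pairing_zero]
    exact hF.integrable (by omega) μ
  · have hlim := fun u => tendsto_truncPairing hF hT hj0 hj (tendsto_const_nhds (x := u))
    refine Integrable.of_bound (C := cbNorm K F * g ^ j) (aestronglyMeasurable_of_tendsto_ae
      Filter.atTop (fun N => (continuous_truncPairing hF hj N).aestronglyMeasurable)
      (ae_of_all _ hlim)) (ae_of_all _ fun u => ?_)
    exact le_of_tendsto (hlim u).norm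
      (Filter.Eventually.of_forall fun N => hF.abs_truncPairing_le hg hT hj0 hj.le N u)

theorem tendsto_integral_truncPairing (hF : MemCb K F) (hg : 0 ≤ g) (hT : HSBound T g)
    (hj : 2 * j < K) (μ : Measure l2) [IsGaussian μ] :
    Filter.Tendsto (fun N => ∫ u, truncPairing N (iteratedFDeriv ℝ (2 * j) F (projN N u)) T ∂μ)
      Filter.atTop (nhds (∫ u, pairing (iteratedFDeriv ℝ (2 * j) F u) T ∂μ)) := by
  have hmeas : ∀ N, AEStronglyMeasurable
      (fun u => truncPairing N (iteratedFDeriv ℝ (2 * j) F (projN N u)) T) μ := fun N =>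
    ((continuous_truncPairing hF hj N).comp (projN N).continuous).aestronglyMeasurable
  rcases Nat.eq_zero_or_pos j with rfl | hj0
  · refine tendsto_integral_of_dominated_convergence (fun u => |F 0| + cbNorm K F * ‖u‖) hmeas
      ((integrable_const _).add ((IsGaussian.integrable_id (μ := μ)).norm.const_mul _))
      (fun N => ae_of_all _ fun u => ?_) (ae_of_all _ fun u => ?_)
    · rw [truncPairing_zero]
      refine (hF.abs_le (by omega) _).trans ?_
      have := cbNorm_nonneg K F
      gcongr
      exact norm_projN_le N u
    · simp only [truncPairing_zero, pairing_zero]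
      exact ((hF.continuous (by omega)).tendsto u).comp (tendsto_projN u)
  · exact tendsto_integral_of_dominated_convergence (fun u => cbNorm K F * g ^ j) hmeas
      (integrable_const _)
      (fun N => ae_of_all _ fun u => hF.abs_truncPairing_le hg hT hj0 hj.le N _)
      (ae_of_all _ fun u => tendsto_truncPairing hF hT hj0 hj (tendsto_projN u))

theorem HSBound.neg (h : HSBound T g) : HSBound (fun a b => -T a b) g := fun N => by
  simpa using h N

theorem truncPairing_neg (N : ℕ) (A : ContinuousMultilinearMap ℝ (fun _ : Fin (2 * j) => l2) ℝ) :
    truncPairing N A (fun a b => -T a b) = (-1) ^ j * truncPairing N A T := by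
  simp only [truncPairing, pairingTerm, tensorPow_neg, Finset.mul_sum]
  exact Finset.sum_congr rfl fun n _ => by ring

/-- The truncated expansion for `ν` projected onto the first `N` coordinates, followed by `N → ∞`.
Positivity of `S - S'` makes `μ` the more spread-out of the two laws. -/
theorem expansion_of_isCenteredGaussian {μ ν : Measure l2} {S S' : ℕ → ℕ → ℝ}
    (hν : IsCenteredGaussian ν S') (hμ : IsCenteredGaussian μ S)
    (hpos : ∀ N, ∀ v : ℕ → ℝ, 0 ≤ ∑ a ∈ Finset.range N, ∑ b ∈ Finset.range N,
      v a * v b * (S a b - S' a b)) (hg : 0 ≤ g) (hT : HSBound (fun a b => S' a b - S a b) g)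
    {s : ℕ} (hF : MemCb (2 * s + 2) F) :
    |∫ u, F u ∂ν - ∑ j ∈ Finset.range (s + 1), 1 / (2 ^ j * (j.factorial : ℝ)) *
        ∫ u, pairing (iteratedFDeriv ℝ (2 * j) F u) (fun a b => S' a b - S a b) ∂μ| ≤
      g ^ (s + 1) / 2 ^ (s + 1) * cbNorm (2 * s + 2) F := by
  have := hν.gaussian
  have := hμ.gaussian
  have hlim0 : Filter.Tendsto (fun N => ∫ u, F (projN N u) ∂ν) Filter.atTop
      (nhds (∫ u, F u ∂ν)) := by
    have := tendsto_integral_truncPairing (j := 0) hF hg hT (by omega) ν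
    simpa only [truncPairing_zero, pairing_zero] using this
  refine le_of_tendsto ((hlim0.sub (tendsto_finsetSum _ fun j hj =>
    (tendsto_integral_truncPairing hF hg hT (j := j)
      (by have := Finset.mem_range.1 hj; omega) μ).const_mul _)).abs)
    (Filter.Eventually.of_forall fun N => ?_)
  -- The interpolation needs the positive matrix `S - S'`; passing back to `S' - S` absorbs the
  -- signs `(-1)^j`.
  have hT' : HSBound (fun a b => S a b - S' a b) g := by simpa using hT.neg
  have hsymm : ∀ a b, S a b - S' a b = S b a - S' b a := by
    intro a b
    rw [← hμ.cov, ← hν.cov, ← hμ.cov, ← hν.cov]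
    simp only [mul_comm]
  obtain ⟨d, c, hc⟩ := exists_factorization hsymm N (hpos N)
  have hint : Integrable (fun x => ‖x‖) (ν.map (projN N)) :=
    (IsGaussian.integrable_id (μ := ν.map (projN N))).norm
  have key := expansion_truncPairing hint hF hc
    (fun u => hF.abs_truncPairing_le hg hT' (j := s + 1) (by omega) (by omega) N u)
  rw [integral_map (by fun_prop) (hF.continuous (by omega)).aestronglyMeasurable] at key
  refine le_of_eq_of_le ?_ (key.trans_eq (by ring))
  congr 2
  refine Finset.sum_congr rfl fun j hj => ?_
  have hj' : 2 * j < 2 * s + 2 := by have := Finset.mem_range.1 hj; omega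
  have h1 : (fun a b => S' a b - S a b) = fun a b => -(S a b - S' a b) := by ext; ring
  have hcont := continuous_truncPairing (T := fun a b => S a b - S' a b) hF hj' N
  have h2 := integral_map (μ := (ν.map (projN N)).prod (gaussPi d))
    (φ := fun z => z.1 + combo (fun i => ∑ a ∈ Finset.range N, c i a • stdVec a) z.2) (by fun_prop)
    hcont.aestronglyMeasurable
  rw [← h2, map_prod_combo hν hμ hc, integral_map (by fun_prop) hcont.aestronglyMeasurable]
  simp only [h1, truncPairing_neg]
  rw [integral_const_mul]
  ring

end Expansion

/-! ### Fractional integrals as integrals against a kernel -/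

/-- The kernel `u ↦ u_+^{a-1}`. -/
noncomputable def rker (a u : ℝ) : ℝ := (Ioi (0 : ℝ)).indicator (fun u => u ^ (a - 1)) u

theorem rker_nonneg (a u : ℝ) : 0 ≤ rker a u :=
  indicator_nonneg (fun _ h => Real.rpow_nonneg (le_of_lt h) _) _

theorem rker_of_pos {a u : ℝ} (h : 0 < u) : rker a u = u ^ (a - 1) := indicator_of_mem h _

theorem rker_of_nonpos {a u : ℝ} (h : u ≤ 0) : rker a u = 0 :=
  indicator_of_notMem (by simpa using h) _

theorem measurable_rker (a : ℝ) : Measurable (rker a) :=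
  (by fun_prop : Measurable fun u : ℝ => u ^ (a - 1)).indicator measurableSet_Ioi

theorem integral_unitVol (f : ℝ → ℝ) : ∫ x, f x ∂unitVol = ∫ x in (0 : ℝ)..1, f x := by
  rw [integral_Icc_eq_integral_Ioc, intervalIntegral.integral_of_le zero_le_one]

theorem integral_mul_rker_left {a x : ℝ} (hx : x ∈ Icc (0 : ℝ) 1) (g : ℝ → ℝ) :
    ∫ t, g t * rker a (x - t) ∂unitVol = ∫ t in (0 : ℝ)..x, g t * (x - t) ^ (a - 1) := by
  have h1 : (fun t => g t * rker a (x - t)) =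
      (Iio x).indicator fun t => g t * (x - t) ^ (a - 1) := by
    ext t
    by_cases ht : t < x
    · rw [rker_of_pos (sub_pos.2 ht), indicator_of_mem (by exact ht)]
    · rw [rker_of_nonpos (by linarith [not_lt.1 ht]), indicator_of_notMem (by exact ht), mul_zero]
  have h2 : Icc (0 : ℝ) 1 ∩ Iio x = Ico 0 x := by
    ext t
    simp only [mem_inter_iff, mem_Icc, mem_Iio, mem_Ico]
    constructor
    · rintro ⟨⟨h, _⟩, h'⟩; exact ⟨h, h'⟩
    · rintro ⟨h, h'⟩; exact ⟨⟨h, by linarith [hx.2]⟩, h'⟩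
  rw [h1, setIntegral_indicator measurableSet_Iio, h2, integral_Ico_eq_integral_Ioo,
    ← integral_Ioc_eq_integral_Ioo, intervalIntegral.integral_of_le hx.1]

theorem integral_mul_rker_right {a t : ℝ} (ht : t ∈ Icc (0 : ℝ) 1) (f : ℝ → ℝ) :
    ∫ x, f x * rker a (x - t) ∂unitVol = ∫ x in t..(1 : ℝ), f x * (x - t) ^ (a - 1) := by
  have h1 : (fun x => f x * rker a (x - t)) =
      (Ioi t).indicator fun x => f x * (x - t) ^ (a - 1) := by
    ext x
    by_cases hx : t < x
    · rw [rker_of_pos (sub_pos.2 hx), indicator_of_mem (by exact hx)]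
    · rw [rker_of_nonpos (by linarith [not_lt.1 hx]), indicator_of_notMem (by exact hx), mul_zero]
  have h2 : Icc (0 : ℝ) 1 ∩ Ioi t = Ioc t 1 := by
    ext x
    simp only [mem_inter_iff, mem_Icc, mem_Ioi, mem_Ioc]
    constructor
    · rintro ⟨⟨_, h⟩, h'⟩; exact ⟨h', h⟩
    · rintro ⟨h, h'⟩; exact ⟨⟨by linarith [ht.1], h'⟩, h⟩
  rw [h1, setIntegral_indicator measurableSet_Ioi, h2, intervalIntegral.integral_of_le ht.2]

theorem integrable_rpow_sub_unitVol {r : ℝ} (hr : -1 < r) (s : ℝ) :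
    Integrable (fun t => (t - s) ^ r) unitVol := by
  have h := (intervalIntegral.intervalIntegrable_rpow' hr (a := 0 - s)
    (b := 1 - s)).comp_sub_right s
  simp only [sub_add_cancel] at h
  exact (integrableOn_Icc_iff_integrableOn_Ioc).2 ((intervalIntegrable_iff_integrableOn_Ioc_of_le
    zero_le_one).1 h)

theorem integrable_rpow_sub_unitVol' {r : ℝ} (hr : -1 < r) (s : ℝ) :
    Integrable (fun t => (s - t) ^ r) unitVol := by
  have h := (intervalIntegral.intervalIntegrable_rpow' hr (a := s - 0) (b := s - 1)).comp_sub_left s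
  simp only [sub_sub_cancel] at h
  exact (integrableOn_Icc_iff_integrableOn_Ioc).2 ((intervalIntegrable_iff_integrableOn_Ioc_of_le
    zero_le_one).1 h)

theorem integrable_rker_left {a : ℝ} (ha : 0 < a) (s : ℝ) :
    Integrable (fun t => rker a (s - t)) unitVol :=
  (integrable_rpow_sub_unitVol' (by linarith : -1 < a - 1) s).indicator
    (measurableSet_lt measurable_const (by fun_prop : Measurable fun t : ℝ => s - t))

theorem integrable_rker_right {a : ℝ} (ha : 0 < a) (s : ℝ) :
    Integrable (fun t => rker a (t - s)) unitVol :=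
  (integrable_rpow_sub_unitVol (by linarith : -1 < a - 1) s).indicator
    (measurableSet_lt measurable_const (by fun_prop : Measurable fun t : ℝ => t - s))

theorem integral_rpow_sub {r : ℝ} (hr : -1 < r) (a b s : ℝ) :
    ∫ t in a..b, (t - s) ^ r = ((b - s) ^ (r + 1) - (a - s) ^ (r + 1)) / (r + 1) := by
  rw [intervalIntegral.integral_comp_sub_right (fun t => t ^ r), integral_rpow (Or.inl hr)]

theorem integral_rker_left_le {a : ℝ} (ha : 0 < a) {x : ℝ} (hx : x ∈ Icc (0 : ℝ) 1) :
    ∫ t, rker a (x - t) ∂unitVol ≤ 1 / a := by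
  have h := integral_mul_rker_left (a := a) hx fun _ => 1
  simp only [one_mul] at h
  rw [h, intervalIntegral.integral_comp_sub_left (fun t => t ^ (a - 1)),
    integral_rpow (Or.inl (by linarith))]
  simp only [sub_self, sub_zero, sub_add_cancel, Real.zero_rpow ha.ne']
  gcongr
  exact Real.rpow_le_one hx.1 hx.2 ha.le

theorem integral_rker_right_le {a : ℝ} (ha : 0 < a) {t : ℝ} (ht : t ∈ Icc (0 : ℝ) 1) :
    ∫ x, rker a (x - t) ∂unitVol ≤ 1 / a := by
  have h := integral_mul_rker_right (a := a) ht fun _ => 1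
  simp only [one_mul] at h
  rw [h, integral_rpow_sub (by linarith)]
  simp only [sub_self, sub_add_cancel, Real.zero_rpow ha.ne', sub_zero]
  gcongr
  exact Real.rpow_le_one (by linarith [ht.2]) (by linarith [ht.1]) ha.le

theorem ae_unitVol_mem : ∀ᵐ x ∂unitVol, x ∈ Icc (0 : ℝ) 1 := ae_restrict_mem measurableSet_Icc

/-- For `a > 0` the integral of the kernel in one variable is at most `1 / a`, uniformly in the
other. -/
theorem integrable_fst_mul_rker {a : ℝ} (ha : 0 < a) {φ : ℝ → ℝ} (hφ : Integrable φ unitVol) :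
    Integrable (fun z : ℝ × ℝ => φ z.1 * rker a (z.1 - z.2)) (unitVol.prod unitVol) := by
  have hm : AEStronglyMeasurable (fun z : ℝ × ℝ => φ z.1 * rker a (z.1 - z.2))
      (unitVol.prod unitVol) := hφ.aestronglyMeasurable.comp_fst.mul
    ((measurable_rker a).comp (by fun_prop)).aestronglyMeasurable
  refine (integrable_prod_iff hm).2
    ⟨ae_of_all _ fun x => (integrable_rker_left ha x).const_mul (φ x), ?_⟩
  have h : ∀ x, ∫ y, ‖φ x * rker a (x - y)‖ ∂unitVol = ‖φ x‖ * ∫ y, rker a (x - y) ∂unitVol := by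
    intro x
    rw [← integral_const_mul]
    simp only [norm_mul, Real.norm_of_nonneg (rker_nonneg _ _)]
  simp only [h]
  have hk : AEStronglyMeasurable (fun x => ∫ y, rker a (x - y) ∂unitVol) unitVol :=
    AEStronglyMeasurable.integral_prod_right' (f := fun z : ℝ × ℝ => rker a (z.1 - z.2))
      ((measurable_rker a).comp (by fun_prop)).aestronglyMeasurable
  refine hφ.norm.mul_bdd (c := 1 / a) hk ?_
  filter_upwards [ae_unitVol_mem] with x hx
  rw [Real.norm_of_nonneg (integral_nonneg fun y => rker_nonneg _ _)]
  exact integral_rker_left_le ha hx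

theorem integrable_snd_mul_rker {a : ℝ} (ha : 0 < a) {φ : ℝ → ℝ} (hφ : Integrable φ unitVol) :
    Integrable (fun z : ℝ × ℝ => φ z.2 * rker a (z.1 - z.2)) (unitVol.prod unitVol) := by
  have hm : AEStronglyMeasurable (fun z : ℝ × ℝ => φ z.2 * rker a (z.1 - z.2))
      (unitVol.prod unitVol) := hφ.aestronglyMeasurable.comp_snd.mul
    ((measurable_rker a).comp (by fun_prop)).aestronglyMeasurable
  refine (integrable_prod_iff' hm).2
    ⟨ae_of_all _ fun x => (integrable_rker_right ha x).const_mul (φ x), ?_⟩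
  have h : ∀ y, ∫ x, ‖φ y * rker a (x - y)‖ ∂unitVol = ‖φ y‖ * ∫ x, rker a (x - y) ∂unitVol := by
    intro y
    rw [← integral_const_mul]
    simp only [norm_mul, Real.norm_of_nonneg (rker_nonneg _ _)]
  simp only [h]
  have hk : AEStronglyMeasurable (fun y => ∫ x, rker a (x - y) ∂unitVol) unitVol :=
    AEStronglyMeasurable.integral_prod_right' (f := fun z : ℝ × ℝ => rker a (z.2 - z.1))
      ((measurable_rker a).comp (by fun_prop)).aestronglyMeasurable
  refine hφ.norm.mul_bdd (c := 1 / a) hk ?_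
  filter_upwards [ae_unitVol_mem] with x hx
  rw [Real.norm_of_nonneg (integral_nonneg fun y => rker_nonneg _ _)]
  exact integral_rker_right_le ha hx

/-- Fractional integration by parts. -/
theorem integral_mul_fracIntLeft {a : ℝ} (ha : 0 < a) {f g : ℝ → ℝ} (hf : MemLp f 2 unitVol)
    (hg : MemLp g 2 unitVol) :
    ∫ x, f x * fracIntLeft a g x ∂unitVol = ∫ t, g t * fracIntRight a f t ∂unitVol := by
  have hint : Integrable (fun z : ℝ × ℝ => f z.1 * (g z.2 * rker a (z.1 - z.2)))
      (unitVol.prod unitVol) := by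
    -- Fubini is justified by `|f(x) g(t)| ≤ f(x)² + g(t)²`: each square is integrable against the
    -- kernel.
    refine ((integrable_fst_mul_rker ha hf.integrable_sq).add
      (integrable_snd_mul_rker ha hg.integrable_sq)).mono' ?_ (ae_of_all _ fun z => ?_)
    · exact hf.aestronglyMeasurable.comp_fst.mul (hg.aestronglyMeasurable.comp_snd.mul
        ((measurable_rker a).comp (by fun_prop)).aestronglyMeasurable)
    · simp only [Pi.add_apply]
      rw [← mul_assoc, norm_mul, Real.norm_of_nonneg (rker_nonneg _ _), ← add_mul]
      refine mul_le_mul_of_nonneg_right ?_ (rker_nonneg _ _)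
      rw [norm_mul, Real.norm_eq_abs, Real.norm_eq_abs, ← sq_abs (f z.1), ← sq_abs (g z.2)]
      nlinarith [sq_nonneg (|f z.1| - |g z.2|), sq_nonneg (|f z.1|), sq_nonneg (|g z.2|)]
  have h1 : ∫ x, f x * fracIntLeft a g x ∂unitVol =
      (Real.Gamma a)⁻¹ * ∫ x, ∫ t, f x * (g t * rker a (x - t)) ∂unitVol ∂unitVol := by
    rw [← integral_const_mul]
    refine integral_congr_ae ?_
    filter_upwards [ae_unitVol_mem] with x hx
    rw [fracIntLeft, if_neg ha.ne', integral_const_mul, integral_mul_rker_left hx]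
    ring
  have h2 : ∫ t, g t * fracIntRight a f t ∂unitVol =
      (Real.Gamma a)⁻¹ * ∫ t, ∫ x, f x * (g t * rker a (x - t)) ∂unitVol ∂unitVol := by
    rw [← integral_const_mul]
    refine integral_congr_ae ?_
    filter_upwards [ae_unitVol_mem] with t ht
    have h3 : ∀ x, f x * (g t * rker a (x - t)) = g t * (f x * rker a (x - t)) := fun x => by ring
    simp only [h3]
    rw [fracIntRight, if_neg ha.ne', integral_const_mul, integral_mul_rker_right ht]
    ring
  rw [h1, h2, integral_integral_swap hint]

/-! ### Beta integrals -/

theorem integral_rpow_mul_rpow_zero {p q b : ℝ} (hp : 0 < p) (hq : 0 < q) (hb : 0 < b) :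
    ∫ t in (0 : ℝ)..b, t ^ (p - 1) * (b - t) ^ (q - 1) =
      b ^ (p + q - 1) * (Real.Gamma p * Real.Gamma q / Real.Gamma (p + q)) := by
  have h := Complex.betaIntegral_scaled p q hb
  have h1 : ∫ t in (0 : ℝ)..b, (t : ℂ) ^ ((p : ℂ) - 1) * ((b : ℂ) - t) ^ ((q : ℂ) - 1) =
      ((∫ t in (0 : ℝ)..b, t ^ (p - 1) * (b - t) ^ (q - 1) : ℝ) : ℂ) := by
    rw [← intervalIntegral.integral_ofReal]
    refine intervalIntegral.integral_congr fun t ht => ?_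
    rw [uIcc_of_le hb.le] at ht
    rw [Complex.ofReal_mul, Complex.ofReal_cpow ht.1, Complex.ofReal_cpow (by linarith [ht.2])]
    push_cast
    rfl
  rw [h1, Complex.betaIntegral_eq_Gamma_mul_div _ _ (by simpa) (by simpa)] at h
  have h2 : ((p : ℂ) + q) = ((p + q : ℝ) : ℂ) := by push_cast; rfl
  have h3 : ((p : ℂ) + q - 1) = ((p + q - 1 : ℝ) : ℂ) := by push_cast; rfl
  rw [h3, h2, Complex.Gamma_ofReal, Complex.Gamma_ofReal, Complex.Gamma_ofReal,
    ← Complex.ofReal_cpow hb.le] at h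
  exact_mod_cast h

theorem integral_rpow_mul_rpow {p q a b : ℝ} (hp : 0 < p) (hq : 0 < q) (hab : a < b) :
    ∫ t in a..b, (t - a) ^ (p - 1) * (b - t) ^ (q - 1) =
      (b - a) ^ (p + q - 1) * (Real.Gamma p * Real.Gamma q / Real.Gamma (p + q)) := by
  rw [← integral_rpow_mul_rpow_zero hp hq (sub_pos.2 hab)]
  have := intervalIntegral.integral_comp_sub_right (a := a) (b := b)
    (fun t => t ^ (p - 1) * (b - a - t) ^ (q - 1)) a
  simp only [sub_self, sub_sub_sub_cancel_right] at this
  exact this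

/-! ### Injectivity of the fractional integral -/

theorem memLp_two_of_continuousOn {f : ℝ → ℝ} (hf : ContinuousOn f (Icc 0 1)) :
    MemLp f 2 unitVol := by
  obtain ⟨C, hC⟩ := isCompact_Icc.exists_bound_of_continuousOn hf
  refine MemLp.of_bound (hf.aestronglyMeasurable measurableSet_Icc) C ?_
  filter_upwards [ae_unitVol_mem] with x hx using hC x hx

theorem rker_sq (a u : ℝ) : rker a u ^ 2 = rker (2 * a - 1) u := by
  rcases le_or_gt u 0 with h | h
  · simp [rker_of_nonpos h]
  · rw [rker_of_pos h, rker_of_pos h, ← Real.rpow_natCast, ← Real.rpow_mul h.le]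
    congr 1
    push_cast
    ring

theorem memLp_two_rker_left {a : ℝ} (ha : 1 / 2 < a) (s : ℝ) :
    MemLp (fun t => rker a (s - t)) 2 unitVol := by
  refine (memLp_two_iff_integrable_sq ((measurable_rker a).comp
    (by fun_prop : Measurable fun t : ℝ => s - t)).aestronglyMeasurable).2 ?_
  simp only [Function.comp_def, rker_sq]
  exact integrable_rker_left (by linarith) s

theorem memLp_two_rker_right {a : ℝ} (ha : 1 / 2 < a) (s : ℝ) :
    MemLp (fun t => rker a (t - s)) 2 unitVol := by
  refine (memLp_two_iff_integrable_sq ((measurable_rker a).comp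
    (by fun_prop : Measurable fun t : ℝ => t - s)).aestronglyMeasurable).2 ?_
  simp only [Function.comp_def, rker_sq]
  exact integrable_rker_right (by linarith) s

/-- This is the Beta integral `B(β, 1 - β)`; the exponents add up to one, so no power of `b - t` is
left. -/
theorem fracIntRight_rker {β b t : ℝ} (hβ0 : 0 < β) (hβ1 : β < 1) (hb : b ≤ 1) (ht : t ≤ 1) :
    fracIntRight β (fun x => rker (1 - β) (b - x)) t =
      (Iio b).indicator (fun _ => Real.Gamma (1 - β)) t := by
  have h1 : (fun x => rker (1 - β) (b - x) * (x - t) ^ (β - 1)) =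
      (Iio b).indicator fun x => (x - t) ^ (β - 1) * (b - x) ^ (1 - β - 1) := by
    ext x
    by_cases hx : x < b
    · rw [rker_of_pos (sub_pos.2 hx), indicator_of_mem (by exact hx), mul_comm]
    · rw [rker_of_nonpos (by linarith [not_lt.1 hx]), indicator_of_notMem (by exact hx), zero_mul]
  have h2 : Ioc t 1 ∩ Iio b = Ioo t b := by
    ext x
    simp only [mem_inter_iff, mem_Ioc, mem_Iio, mem_Ioo]
    constructor
    · rintro ⟨⟨h, _⟩, h'⟩; exact ⟨h, h'⟩
    · rintro ⟨h, h'⟩; exact ⟨⟨h, by linarith⟩, h'⟩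
  rw [fracIntRight, if_neg hβ0.ne', h1, intervalIntegral.integral_of_le ht,
    setIntegral_indicator measurableSet_Iio, h2, ← integral_Ioc_eq_integral_Ioo]
  by_cases htb : t < b
  · rw [indicator_of_mem (by exact htb), ← intervalIntegral.integral_of_le htb.le,
      integral_rpow_mul_rpow hβ0 (by linarith) htb]
    have := Real.Gamma_pos_of_pos hβ0
    simp only [add_sub_cancel, sub_self, Real.rpow_zero, Real.Gamma_one]
    field_simp
  · rw [indicator_of_notMem (by exact htb), Ioc_eq_empty htb]
    simp

theorem eq_of_forall_integral_eq {g₁ g₂ : L2}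
    (h : ∀ b ∈ Icc (0 : ℝ) 1, ∫ t in (0 : ℝ)..b, g₁ t = ∫ t in (0 : ℝ)..b, g₂ t) : g₁ = g₂ := by
  have hi : ∀ g : L2, IntervalIntegrable g volume 0 1 := fun g => by
    rw [intervalIntegrable_iff_integrableOn_Icc_of_le zero_le_one]
    exact (Lp.memLp g).integrable (by norm_num)
  have hz : (0 : ℝ) ∈ uIcc (0 : ℝ) 1 := by simp
  refine Lp.ext ?_
  have h1 := (hi g₁).ae_hasDerivAt_integral
  have h2 := (hi g₂).ae_hasDerivAt_integral
  -- At an interior point the two primitives agree on a neighbourhood, so their derivatives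
  -- coincide; Lebesgue differentiation identifies these with `g₁` and `g₂`.
  have h3 : ∀ᵐ x : ℝ, x ∈ Icc (0 : ℝ) 1 → x ∈ Ioo (0 : ℝ) 1 := by
    have a1 : ∀ᵐ x : ℝ, x ≠ 0 := by simp [ae_iff, measure_singleton]
    have a2 : ∀ᵐ x : ℝ, x ≠ 1 := by simp [ae_iff, measure_singleton]
    filter_upwards [a1, a2] with x hx1 hx2 hx'
    exact ⟨lt_of_le_of_ne hx'.1 (Ne.symm hx1), lt_of_le_of_ne hx'.2 hx2⟩
  rw [Filter.EventuallyEq, ae_restrict_iff' measurableSet_Icc]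
  filter_upwards [h1, h2, h3] with x hx1 hx2 hx3 hx
  have hx' : x ∈ uIcc (0 : ℝ) 1 := by rwa [uIcc_of_le zero_le_one]
  refine (hx1 hx' 0 hz).unique ((hx2 hx' 0 hz).congr_of_eventuallyEq ?_)
  filter_upwards [isOpen_Ioo.mem_nhds (hx3 hx)] with y hy using h y (Ioo_subset_Icc_self hy)

/-- Abel inversion. Integrating `I_{0+}^β g` against `(b - x)_+^{-β}`, which is in `L²` because `β <
1/2`, recovers `Γ(1-β) ∫₀ᵇ g` for every `b`. -/
theorem fracIntLeft_injective {β : ℝ} (hβ0 : 0 ≤ β) (hβ : β < 1 / 2) {g₁ g₂ : L2}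
    (h : fracIntLeft β g₁ =ᵐ[unitVol] fracIntLeft β g₂) : g₁ = g₂ := by
  rcases hβ0.eq_or_lt with rfl | hβ0
  · refine Lp.ext ?_
    simpa [Filter.EventuallyEq, fracIntLeft] using h
  refine eq_of_forall_integral_eq fun b hb => ?_
  have hG := Real.Gamma_pos_of_pos (by linarith : 0 < 1 - β)
  have key : ∀ g : L2, ∫ x, rker (1 - β) (b - x) * fracIntLeft β g x ∂unitVol =
      Real.Gamma (1 - β) * ∫ t in (0 : ℝ)..b, g t := by
    intro g
    rw [integral_mul_fracIntLeft hβ0 (memLp_two_rker_left (by linarith) b) (Lp.memLp g)]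
    have h1 : ∫ t, g t * fracIntRight β (fun x => rker (1 - β) (b - x)) t ∂unitVol =
        ∫ t, (Iio b).indicator (fun t => Real.Gamma (1 - β) * g t) t ∂unitVol := by
      refine integral_congr_ae ?_
      filter_upwards [ae_unitVol_mem] with t ht
      rw [fracIntRight_rker hβ0 (by linarith) hb.2 ht.2]
      by_cases htb : t < b
      · rw [indicator_of_mem (by exact htb), indicator_of_mem (by exact htb), mul_comm]
      · rw [indicator_of_notMem (by exact htb), indicator_of_notMem (by exact htb), mul_zero]
    have h2 : Icc (0 : ℝ) 1 ∩ Iio b = Ico 0 b := by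
      ext t
      simp only [mem_inter_iff, mem_Icc, mem_Iio, mem_Ico]
      constructor
      · rintro ⟨⟨h, _⟩, h'⟩; exact ⟨h, h'⟩
      · rintro ⟨h, h'⟩; exact ⟨⟨h, by linarith [hb.2]⟩, h'⟩
    rw [h1, setIntegral_indicator measurableSet_Iio, h2, integral_Ico_eq_integral_Ioo,
      ← integral_Ioc_eq_integral_Ioo, integral_const_mul, intervalIntegral.integral_of_le hb.1]
  have h3 : ∫ x, rker (1 - β) (b - x) * fracIntLeft β g₁ x ∂unitVol =
      ∫ x, rker (1 - β) (b - x) * fracIntLeft β g₂ x ∂unitVol :=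
    integral_congr_ae (by filter_upwards [h] with x hx; rw [hx])
  rw [key, key] at h3
  exact mul_left_cancel₀ hG.ne' h3

/-- By injectivity the choice made in `fracDeriv` is irrelevant: any explicit preimage is the
fractional derivative. -/
theorem fracDeriv_eq {β : ℝ} (hβ0 : 0 ≤ β) (hβ : β < 1 / 2) {f : ℝ → ℝ} {g : L2}
    (h : f =ᵐ[unitVol] fracIntLeft β g) : fracDeriv β f = g := by
  have hex : ∃ g : L2, f =ᵐ[unitVol] fracIntLeft β g := ⟨g, h⟩
  rw [fracDeriv, dif_pos hex]
  exact fracIntLeft_injective hβ0 hβ (hex.choose_spec.symm.trans h)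

/-! ### Fractional integrals of step functions -/

/-- The fractional integral of order `1 - β` of the indicator of `[a,∞)`. -/
noncomputable def ramp (β a x : ℝ) : ℝ := (Real.Gamma (2 - β))⁻¹ * max (x - a) 0 ^ (1 - β)

theorem continuous_ramp {β : ℝ} (hβ : β < 1) (a : ℝ) : Continuous (ramp β a) := by
  unfold ramp
  refine continuous_const.mul (Continuous.rpow_const (by fun_prop) fun x => Or.inr (by linarith))

theorem Gamma_two_sub {β : ℝ} (hβ : β < 1) :
    Real.Gamma (2 - β) = (1 - β) * Real.Gamma (1 - β) := by
  rw [← Real.Gamma_add_one (by linarith)]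
  congr 1
  ring

theorem fracIntLeft_indicator {β a x : ℝ} (hβ : β < 1) (ha : 0 ≤ a) (hx : 0 ≤ x) :
    fracIntLeft (1 - β) ((Ici a).indicator fun _ => 1) x = ramp β a x := by
  have h1 : (fun t => (Ici a).indicator (fun _ => (1 : ℝ)) t * (x - t) ^ (1 - β - 1)) =
      (Ici a).indicator fun t => (x - t) ^ (1 - β - 1) := by
    ext t
    by_cases ht : t ∈ Ici a <;> simp [ht]
  have h2 : Ico 0 x ∩ Ici a = Ico a x := by
    ext t
    simp only [mem_inter_iff, mem_Ico, mem_Ici]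
    constructor
    · rintro ⟨⟨_, h⟩, h'⟩; exact ⟨h', h⟩
    · rintro ⟨h, h'⟩; exact ⟨⟨by linarith, h'⟩, h⟩
  have hG := Real.Gamma_pos_of_pos (by linarith : 0 < 1 - β)
  rw [fracIntLeft, if_neg (by linarith), h1, intervalIntegral.integral_of_le hx,
    integral_Ioc_eq_integral_Ioo, ← integral_Ico_eq_integral_Ioo,
    setIntegral_indicator measurableSet_Ici, h2, integral_Ico_eq_integral_Ioo,
    ← integral_Ioc_eq_integral_Ioo, ramp, Gamma_two_sub hβ]
  rcases le_or_gt x a with h | h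
  · rw [Ioc_eq_empty (by linarith), max_eq_right (by linarith), Real.zero_rpow (by linarith)]
    simp
  · rw [← intervalIntegral.integral_of_le h.le,
      intervalIntegral.integral_comp_sub_left (fun t => t ^ (1 - β - 1)),
      integral_rpow (Or.inl (by linarith)), max_eq_left (by linarith)]
    simp only [sub_self, sub_add_cancel, Real.zero_rpow (by linarith : 1 - β ≠ 0), sub_zero]
    have : 1 - β ≠ 0 := by linarith
    field_simp

theorem integral_indicator_Ici {a x : ℝ} (ha : 0 ≤ a) (hx : 0 ≤ x) :
    ∫ t in (0 : ℝ)..x, (Ici a).indicator (fun _ => (1 : ℝ)) t = max (x - a) 0 := by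
  have := fracIntLeft_indicator (β := 0) (by norm_num) ha hx
  simpa [fracIntLeft, ramp] using this

/-- The semigroup law `I^β I^{1-β} = I^1` on a step function, again a Beta integral. It exhibits the
fractional derivative of a hinge `(x - a)_+`. -/
theorem fracIntLeft_ramp {β a x : ℝ} (hβ0 : 0 ≤ β) (hβ : β < 1) (ha : 0 ≤ a) (hx : 0 ≤ x) :
    fracIntLeft β (ramp β a) x = max (x - a) 0 := by
  rcases hβ0.eq_or_lt with rfl | hβ0
  · simp [fracIntLeft, ramp]
  have hG2 := Real.Gamma_pos_of_pos (by linarith : 0 < 2 - β)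
  have hG := Real.Gamma_pos_of_pos hβ0
  have h1 : (fun t => ramp β a t * (x - t) ^ (β - 1)) = (Ioi a).indicator fun t =>
      (Real.Gamma (2 - β))⁻¹ * ((t - a) ^ (2 - β - 1) * (x - t) ^ (β - 1)) := by
    ext t
    by_cases ht : a < t
    · rw [indicator_of_mem (by exact ht), ramp, max_eq_left (by linarith),
        (by ring : 1 - β = 2 - β - 1), mul_assoc]
    · rw [indicator_of_notMem (by exact ht), ramp, max_eq_right (by linarith [not_lt.1 ht]),
        Real.zero_rpow (by linarith), mul_zero, zero_mul]
  have h2 : Ioc 0 x ∩ Ioi a = Ioc a x := by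
    ext t
    simp only [mem_inter_iff, mem_Ioc, mem_Ioi]
    constructor
    · rintro ⟨⟨_, h⟩, h'⟩; exact ⟨h', h⟩
    · rintro ⟨h, h'⟩; exact ⟨⟨by linarith, h'⟩, h⟩
  rw [fracIntLeft, if_neg hβ0.ne', h1, intervalIntegral.integral_of_le hx,
    setIntegral_indicator measurableSet_Ioi, h2, integral_const_mul]
  rcases le_or_gt x a with h | h
  · rw [Ioc_eq_empty (by linarith), max_eq_right (by linarith)]
    simp
  · rw [← intervalIntegral.integral_of_le h.le, integral_rpow_mul_rpow (by linarith) hβ0 h,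
      max_eq_left (by linarith), sub_add_cancel, Real.Gamma_two]
    norm_num
    field_simp

theorem intervalIntegrable_mul_rpow {β : ℝ} (hβ : 0 < β) {u : ℝ → ℝ} (hu : Continuous u) (x : ℝ) :
    IntervalIntegrable (fun t => u t * (x - t) ^ (β - 1)) volume 0 x := by
  have h := (intervalIntegral.intervalIntegrable_rpow' (by linarith : -1 < β - 1)
    (a := x - 0) (b := x - x)).comp_sub_left x
  simp only [sub_sub_cancel] at h
  exact h.continuousOn_mul hu.continuousOn

theorem fracIntLeft_sum_smul {β : ℝ} (hβ : 0 ≤ β) {ι : Type*} (I : Finset ι) (c : ι → ℝ)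
    {u : ι → ℝ → ℝ} (hu : ∀ i, Continuous (u i)) (x : ℝ) :
    fracIntLeft β (fun t => ∑ i ∈ I, c i * u i t) x = ∑ i ∈ I, c i * fracIntLeft β (u i) x := by
  rcases hβ.eq_or_lt with rfl | hβ
  · simp [fracIntLeft]
  simp only [fracIntLeft, if_neg hβ.ne', Finset.sum_mul]
  rw [intervalIntegral.integral_finsetSum fun i _ => by
    simpa only [mul_assoc] using (intervalIntegrable_mul_rpow hβ (hu i) x).const_mul (c i)]
  rw [Finset.mul_sum]
  refine Finset.sum_congr rfl fun i _ => ?_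
  simp only [mul_assoc]
  rw [intervalIntegral.integral_const_mul]
  ring

theorem fracIntLeft_sub {β : ℝ} (hβ : 0 ≤ β) {u v : ℝ → ℝ} (hu : Continuous u)
    (hv : Continuous v) (x : ℝ) :
    fracIntLeft β (fun t => u t - v t) x = fracIntLeft β u x - fracIntLeft β v x := by
  rcases hβ.eq_or_lt with rfl | hβ
  · simp [fracIntLeft]
  simp only [fracIntLeft, if_neg hβ.ne', sub_mul]
  rw [intervalIntegral.integral_sub (intervalIntegrable_mul_rpow hβ hu x)
    (intervalIntegrable_mul_rpow hβ hv x), mul_sub]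

theorem fracIntLeft_congr_ae {β x : ℝ} (hβ : 0 < β) (hx : x ∈ Icc (0 : ℝ) 1) {u v : ℝ → ℝ}
    (h : u =ᵐ[unitVol] v) : fracIntLeft β u x = fracIntLeft β v x := by
  rw [fracIntLeft, fracIntLeft, if_neg hβ.ne', if_neg hβ.ne', ← integral_mul_rker_left hx,
    ← integral_mul_rker_left hx]
  congr 1
  refine integral_congr_ae ?_
  filter_upwards [h] with t ht
  rw [ht]

/-- The class of `ramp β a` in `L²`. -/
noncomputable def rampLp {β : ℝ} (hβ : β < 1) (a : ℝ) : L2 :=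
  (memLp_two_of_continuousOn (continuous_ramp hβ a).continuousOn).toLp (ramp β a)

theorem coeFn_rampLp {β : ℝ} (hβ : β < 1) (a : ℝ) : rampLp hβ a =ᵐ[unitVol] ramp β a :=
  MemLp.coeFn_toLp _

theorem inner_L2_eq (f g : L2) : ⟪f, g⟫_ℝ = ∫ x, f x * g x ∂unitVol := by
  rw [L2.inner_def]
  simp [mul_comm]

/-- `ramp β a` is `I_{0+}^{1-β}` of a step; integration by parts moves the operator onto `e_n` and
creates `k_n`. -/
theorem inner_rampLp {β a : ℝ} (hβ : β < 1) (ha : a ∈ Icc (0 : ℝ) 1) (e : HilbertBasis ℕ ℝ L2)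
    (n : ℕ) : ⟪e n, rampLp hβ a⟫_ℝ = ∫ t in a..1, kFun β e n t := by
  have h1 : ∫ x, e n x * rampLp hβ a x ∂unitVol =
      ∫ x, e n x * fracIntLeft (1 - β) ((Ici a).indicator fun _ => 1) x ∂unitVol := by
    refine integral_congr_ae ?_
    filter_upwards [coeFn_rampLp hβ a, ae_unitVol_mem] with x hx hx'
    rw [hx, fracIntLeft_indicator hβ ha.1 hx'.1]
  have h2 : MemLp ((Ici a).indicator fun _ => (1 : ℝ)) 2 unitVol :=
    (memLp_const 1).indicator measurableSet_Ici
  have h3 : (fun t => (Ici a).indicator (fun _ => (1 : ℝ)) t * fracIntRight (1 - β) (e n) t) =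
      (Ici a).indicator (kFun β e n) := by
    ext t
    by_cases ht : t ∈ Ici a <;> simp [ht, kFun]
  have h4 : Icc (0 : ℝ) 1 ∩ Ici a = Icc a 1 := by
    ext t
    simp only [mem_inter_iff, mem_Icc, mem_Ici]
    constructor
    · rintro ⟨⟨_, h⟩, h'⟩; exact ⟨h', h⟩
    · rintro ⟨h, h'⟩; exact ⟨⟨by linarith [ha.1], h'⟩, h⟩
  rw [inner_L2_eq, h1, integral_mul_fracIntLeft (by linarith) (Lp.memLp _) h2, h3,
    setIntegral_indicator measurableSet_Ici, h4, integral_Icc_eq_integral_Ioc,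
    intervalIntegral.integral_of_le ha.2]

/-! ### The image of an interpolated path -/

/-- The image under `J_β` of the interpolation of the unit step on the `i`-th cell. -/
noncomputable def cellVec {β : ℝ} (hβ : β < 1) (e : HilbertBasis ℕ ℝ L2) (m i : ℕ) : l2 :=
  e.repr (rampLp hβ (i / m) - rampLp hβ ((i + 1) / m))

theorem interp_eq (m : ℕ) (b : ℝ≥0 → ℝ) {t : ℝ} (ht : 0 ≤ t) :
    interp m b t = ∑ i ∈ Finset.range m, (m * (b (((i : ℝ≥0) + 1) / m) - b ((i : ℝ≥0) / m))) *
      (max (t - i / m) 0 - max (t - (i + 1) / m) 0) := by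
  have h1 : ∀ (a : ℝ), IntervalIntegrable ((Ici a).indicator fun _ => (1 : ℝ)) volume 0 t :=
    fun a => (intervalIntegrable_iff_integrableOn_Ioc_of_le ht).2
      ((integrableOn_const (by simp)).indicator measurableSet_Ici)
  have h2 : ∀ i : ℕ, (Ico ((i : ℝ) / m) (((i : ℝ) + 1) / m)).indicator (fun _ => (1 : ℝ)) =
      fun r => (Ici ((i : ℝ) / m)).indicator (fun _ => (1 : ℝ)) r -
        (Ici (((i : ℝ) + 1) / m)).indicator (fun _ => (1 : ℝ)) r := by
    intro i
    ext r
    have : (i : ℝ) / m ≤ ((i : ℝ) + 1) / m := by gcongr; linarith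
    simp only [indicator_apply, mem_Ico, mem_Ici]
    grind
  unfold interp
  rw [intervalIntegral.integral_const_mul, intervalIntegral.integral_finsetSum, Finset.mul_sum]
  · refine Finset.sum_congr rfl fun i _ => ?_
    rw [intervalIntegral.integral_const_mul, h2, intervalIntegral.integral_sub (h1 _) (h1 _),
      integral_indicator_Ici (by positivity) ht, integral_indicator_Ici (by positivity) ht]
    ring
  · intro i _
    rw [h2]
    exact ((h1 _).sub (h1 _)).const_mul _

/-- An interpolated path is a combination of hinges, whose preimages under `I_{0+}^β` are ramps;
hence its image is linear in the increments. -/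
theorem isoJ_interp {β : ℝ} (hβ0 : 0 ≤ β) (hβ : β < 1 / 2) (e : HilbertBasis ℕ ℝ L2) (m : ℕ)
    (b : ℝ≥0 → ℝ) : isoJ β e (interp m b) = ∑ i ∈ Finset.range m,
      (m * (b (((i : ℝ≥0) + 1) / m) - b ((i : ℝ≥0) / m))) •
        cellVec (by linarith : β < 1) e m i := by
  have hβ1 : β < 1 := by linarith
  set c : ℕ → ℝ := fun i => m * (b (((i : ℝ≥0) + 1) / m) - b ((i : ℝ≥0) / m)) with hc
  set u : ℕ → ℝ → ℝ := fun i t => ramp β (i / m) t - ramp β ((i + 1) / m) t with hu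
  have hucont : ∀ i, Continuous (u i) := fun i =>
    (continuous_ramp hβ1 _).sub (continuous_ramp hβ1 _)
  set g : L2 := ∑ i ∈ Finset.range m, c i • (rampLp hβ1 (i / m) - rampLp hβ1 ((i + 1) / m)) with hg
  have hgu : g =ᵐ[unitVol] fun t => ∑ i ∈ Finset.range m, c i * u i t := by
    have h1 : ∀ i, (c i • (rampLp hβ1 (i / m) - rampLp hβ1 ((i + 1) / m)) : L2) =ᵐ[unitVol]
        fun t => c i * u i t := by
      intro i
      filter_upwards [Lp.coeFn_smul (c i) (rampLp hβ1 (i / m) - rampLp hβ1 ((i + 1) / m)),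
        Lp.coeFn_sub (rampLp hβ1 (i / m)) (rampLp hβ1 ((i + 1) / m)),
        coeFn_rampLp hβ1 ((i : ℝ) / m), coeFn_rampLp hβ1 (((i : ℝ) + 1) / m)] with t h1 h2 h3 h4
      rw [h1, Pi.smul_apply, h2, Pi.sub_apply, h3, h4, smul_eq_mul]
    filter_upwards [Lp.coeFn_finsetSum (Finset.range m) fun i : ℕ =>
      c i • (rampLp hβ1 (i / m) - rampLp hβ1 ((i + 1) / m)), ae_all_iff.2 h1] with t h2 h3
    rw [h2, Finset.sum_apply]
    exact Finset.sum_congr rfl fun i _ => h3 i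
  have hfrac : ∀ x ∈ Icc (0 : ℝ) 1,
      fracIntLeft β (fun t => ∑ i ∈ Finset.range m, c i * u i t) x = interp m b x := by
    intro x hx
    rw [fracIntLeft_sum_smul hβ0 _ _ hucont, interp_eq m b hx.1]
    refine Finset.sum_congr rfl fun i _ => ?_
    rw [fracIntLeft_sub hβ0 (continuous_ramp hβ1 _) (continuous_ramp hβ1 _),
      fracIntLeft_ramp hβ0 hβ1 (by positivity) hx.1, fracIntLeft_ramp hβ0 hβ1 (by positivity) hx.1]
  have hd : fracDeriv β (interp m b) = g := by
    refine fracDeriv_eq hβ0 hβ ?_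
    -- For `β > 0` the integral does not see null sets, so equality holds at every point of `[0,1]`;
    -- for `β = 0` the operator is the identity and equality holds only almost everywhere.
    rcases hβ0.eq_or_lt with rfl | hβ0
    · filter_upwards [ae_unitVol_mem, hgu] with x hx hgx
      rw [← hfrac x hx]
      simp [fracIntLeft, hgx]
    · filter_upwards [ae_unitVol_mem] with x hx
      rw [← hfrac x hx, fracIntLeft_congr_ae hβ0 hx hgu]
  rw [isoJ, hd, hg, map_sum]
  simp only [map_smul]
  rfl

/-! ### Regularity of the functions `k_n` -/

/-- The kernel `t ↦ (t - s)_+^{-β}` in `L²`. -/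
noncomputable def kerLp {β : ℝ} (hβ : β < 1 / 2) (s : ℝ) : L2 :=
  (memLp_two_rker_right (by linarith : 1 / 2 < 1 - β) s).toLp _

/-- Presenting `k_n(s)` as a basis coefficient lets Bessel's inequality turn sums over `n` into `L²`
norms. -/
theorem kFun_eq {β s : ℝ} (hβ : β < 1 / 2) (hs : s ∈ Icc (0 : ℝ) 1) (e : HilbertBasis ℕ ℝ L2)
    (n : ℕ) : kFun β e n s = (Real.Gamma (1 - β))⁻¹ * ⟪e n, kerLp hβ s⟫_ℝ := by
  rw [kFun, fracIntRight, if_neg (by linarith), inner_L2_eq, ← integral_mul_rker_right hs]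
  congr 1
  refine integral_congr_ae ?_
  filter_upwards [MemLp.coeFn_toLp (memLp_two_rker_right (by linarith : 1 / 2 < 1 - β) s)] with t ht
  rw [kerLp, ht]

theorem integral_rker_right {a t : ℝ} (ha : 0 < a) (ht : t ∈ Icc (0 : ℝ) 1) :
    ∫ x, rker a (x - t) ∂unitVol = (1 - t) ^ a / a := by
  have h := integral_mul_rker_right (a := a) ht fun _ => 1
  simp only [one_mul] at h
  rw [h, integral_rpow_sub (by linarith)]
  simp [Real.zero_rpow ha.ne']

/-- Let `u`, `v` be the kernels started at `s ≤ s'`. Past `s'` one has `0 ≤ u ≤ v`, so `(u - v)² ≤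
v² - u²`; before `s'` one has `v = 0`, and the correction `2u²` is needed. The integral of `v² - u²`
over `[0,1]` is nonpositive, so only the correction remains. -/
theorem integral_sq_rker_sub_le {a s s' : ℝ} (ha : 1 / 2 < a) (ha1 : a ≤ 1) (hs : s ∈ Icc (0 : ℝ) 1)
    (hs' : s' ∈ Icc (0 : ℝ) 1) (h : s ≤ s') :
    ∫ t, (rker a (t - s) - rker a (t - s')) ^ 2 ∂unitVol ≤
      2 * (s' - s) ^ (2 * a - 1) / (2 * a - 1) := by
  have hp : 0 < 2 * a - 1 := by linarith
  have i1 := integrable_rker_right hp s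
  have i2 := integrable_rker_right hp s'
  have i3 := i1.indicator (measurableSet_Iic (a := s'))
  have h1 : ∫ t, (Iic s').indicator (fun t => rker (2 * a - 1) (t - s)) t ∂unitVol =
      (s' - s) ^ (2 * a - 1) / (2 * a - 1) := by
    have e1 : (Iic s').indicator (fun t => rker (2 * a - 1) (t - s)) =
        (Ioc s s').indicator fun t => (t - s) ^ (2 * a - 1 - 1) := by
      ext t
      by_cases ht : t ≤ s'
      · rw [indicator_of_mem (by exact ht)]
        by_cases ht' : s < t
        · rw [indicator_of_mem (show t ∈ Ioc s s' from ⟨ht', ht⟩), rker_of_pos (by linarith)]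
        · rw [indicator_of_notMem (fun h : t ∈ Ioc s s' => ht' h.1), rker_of_nonpos (by linarith)]
      · rw [indicator_of_notMem (by exact ht), indicator_of_notMem (fun h : t ∈ Ioc s s' => ht h.2)]
    have e2 : Icc (0 : ℝ) 1 ∩ Ioc s s' = Ioc s s' :=
      inter_eq_right.2 fun t ht => ⟨by linarith [ht.1, hs.1], by linarith [ht.2, hs'.2]⟩
    rw [e1, setIntegral_indicator measurableSet_Ioc, e2, ← intervalIntegral.integral_of_le h,
      integral_rpow_sub (by linarith)]
    simp [Real.zero_rpow hp.ne']
  calc ∫ t, (rker a (t - s) - rker a (t - s')) ^ 2 ∂unitVol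
      ≤ ∫ t, (rker (2 * a - 1) (t - s') - rker (2 * a - 1) (t - s) +
        2 * (Iic s').indicator (fun t => rker (2 * a - 1) (t - s)) t) ∂unitVol := by
        refine integral_mono ?_ ((i2.sub i1).add (i3.const_mul 2)) fun t => ?_
        · exact ((memLp_two_rker_right ha s).sub (memLp_two_rker_right ha s')).integrable_sq
        · simp only
          have hn := rker_nonneg a (t - s)
          have hn' := rker_nonneg a (t - s')
          rcases le_or_gt t s' with ht | ht
          · rw [indicator_of_mem (by exact ht), ← rker_sq, ← rker_sq,
              rker_of_nonpos (by linarith : t - s' ≤ 0)]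
            nlinarith
          · rw [indicator_of_notMem (by exact not_le.2 ht), ← rker_sq, ← rker_sq]
            have : rker a (t - s) ≤ rker a (t - s') := by
              rw [rker_of_pos (by linarith), rker_of_pos (by linarith)]
              exact Real.rpow_le_rpow_of_nonpos (by linarith) (by linarith) (by linarith)
            nlinarith
    _ = ((1 - s') ^ (2 * a - 1) - (1 - s) ^ (2 * a - 1) + 2 * (s' - s) ^ (2 * a - 1)) /
          (2 * a - 1) := by
        have i4 : Integrable
            (fun t => rker (2 * a - 1) (t - s') - rker (2 * a - 1) (t - s)) unitVol :=
          i2.sub i1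
        rw [integral_add i4 (i3.const_mul 2), integral_sub i2 i1, integral_const_mul, h1,
          integral_rker_right hp hs, integral_rker_right hp hs']
        ring
    _ ≤ 2 * (s' - s) ^ (2 * a - 1) / (2 * a - 1) := by
        gcongr
        have : (1 - s') ^ (2 * a - 1) ≤ (1 - s) ^ (2 * a - 1) := by
          have := hs'.2
          gcongr
        linarith

theorem norm_kerLp_sub_sq_le {β s s' : ℝ} (hβ0 : 0 ≤ β) (hβ : β < 1 / 2) (hs : s ∈ Icc (0 : ℝ) 1)
    (hs' : s' ∈ Icc (0 : ℝ) 1) :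
    ‖kerLp hβ s - kerLp hβ s'‖ ^ 2 ≤ 2 * |s - s'| ^ (1 - 2 * β) / (1 - 2 * β) := by
  wlog h : s ≤ s' generalizing s s'
  · rw [norm_sub_rev, abs_sub_comm]
    exact this hs' hs (by linarith)
  have ha : 1 / 2 < 1 - β := by linarith
  have := integral_sq_rker_sub_le ha (by linarith) hs hs' h
  rw [abs_sub_comm, abs_of_nonneg (by linarith), ← real_inner_self_eq_norm_sq, inner_L2_eq]
  rw [(by ring : 1 - 2 * β = 2 * (1 - β) - 1)]
  refine le_of_eq_of_le (integral_congr_ae ?_) this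
  filter_upwards [Lp.coeFn_sub (kerLp hβ s) (kerLp hβ s'),
    MemLp.coeFn_toLp (memLp_two_rker_right ha s),
    MemLp.coeFn_toLp (memLp_two_rker_right ha s')] with t h1 h2 h3
  rw [h1, Pi.sub_apply, kerLp, kerLp, h2, h3]
  ring

/-- The constant in the Hölder estimate for `(k_n)`. -/
noncomputable def kConst (β : ℝ) : ℝ := (Real.Gamma (1 - β))⁻¹ ^ 2 * (2 / (1 - 2 * β))

theorem kConst_nonneg {β : ℝ} (hβ : β < 1 / 2) : 0 ≤ kConst β := by
  have : 0 < 1 - 2 * β := by linarith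
  unfold kConst
  positivity

theorem sum_kFun_sub_sq_le {β s s' : ℝ} (hβ0 : 0 ≤ β) (hβ : β < 1 / 2) (hs : s ∈ Icc (0 : ℝ) 1)
    (hs' : s' ∈ Icc (0 : ℝ) 1) (e : HilbertBasis ℕ ℝ L2) (I : Finset ℕ) :
    ∑ n ∈ I, (kFun β e n s - kFun β e n s') ^ 2 ≤ kConst β * |s - s'| ^ (1 - 2 * β) := by
  have h1 := e.orthonormal.sum_inner_products_le (kerLp hβ s - kerLp hβ s') (s := I)
  have h2 := norm_kerLp_sub_sq_le hβ0 hβ hs hs'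
  have h3 : ∀ n, (kFun β e n s - kFun β e n s') ^ 2 =
      (Real.Gamma (1 - β))⁻¹ ^ 2 * ‖⟪e n, kerLp hβ s - kerLp hβ s'⟫_ℝ‖ ^ 2 := by
    intro n
    rw [kFun_eq hβ hs, kFun_eq hβ hs', inner_sub_right, Real.norm_eq_abs, sq_abs]
    ring
  simp only [h3, ← Finset.mul_sum]
  rw [kConst, mul_assoc]
  refine mul_le_mul_of_nonneg_left ((h1.trans h2).trans_eq ?_) (sq_nonneg _)
  ring

theorem continuousOn_kFun {β : ℝ} (hβ0 : 0 ≤ β) (hβ : β < 1 / 2) (e : HilbertBasis ℕ ℝ L2) (n : ℕ) :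
    ContinuousOn (kFun β e n) (Icc 0 1) := by
  intro s hs
  have hp : 0 < 1 - 2 * β := by linarith
  have hb : ∀ t ∈ Icc (0 : ℝ) 1, |kFun β e n t - kFun β e n s| ≤
      √(kConst β * |t - s| ^ (1 - 2 * β)) := fun t ht => by
    have := sum_kFun_sub_sq_le hβ0 hβ ht hs e {n}
    rw [Finset.sum_singleton] at this
    exact Real.abs_le_sqrt this
  have hc : Continuous fun t => √(kConst β * |t - s| ^ (1 - 2 * β)) :=
    (continuous_const.mul (Continuous.rpow_const (by fun_prop) fun x => Or.inr hp.le)).sqrt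
  have hz : Filter.Tendsto (fun t => √(kConst β * |t - s| ^ (1 - 2 * β))) (nhdsWithin s (Icc 0 1))
      (nhds 0) := by
    have := (hc.tendsto s).mono_left (nhdsWithin_le_nhds (s := Icc 0 1))
    simpa [Real.zero_rpow hp.ne'] using this
  refine tendsto_iff_norm_sub_tendsto_zero.2 (squeeze_zero_norm' ?_ hz)
  filter_upwards [self_mem_nhdsWithin] with t ht
  simpa using hb t ht

/-! ### The covariance matrices -/

section Cells

variable {m : ℕ}

/-- The integral over the `i`-th cell. -/
noncomputable abbrev cellInt (m i : ℕ) (f : ℝ → ℝ) : ℝ :=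
  ∫ t in ((i : ℝ) / m)..(((i : ℝ) + 1) / m), f t

theorem cell_le (m i : ℕ) : (i : ℝ) / m ≤ ((i : ℝ) + 1) / m := by gcongr; linarith

theorem cell_subset {i : ℕ} (hi : i < m) :
    Icc ((i : ℝ) / m) (((i : ℝ) + 1) / m) ⊆ Icc 0 1 := by
  have hm : (0 : ℝ) < m := by exact_mod_cast (Nat.zero_le i).trans_lt hi
  refine Icc_subset_Icc (by positivity) ?_
  rw [div_le_one hm]
  exact_mod_cast hi

theorem intervalIntegrable_cell {i : ℕ} (hi : i < m) {f : ℝ → ℝ} (hf : ContinuousOn f (Icc 0 1)) :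
    IntervalIntegrable f volume ((i : ℝ) / m) (((i : ℝ) + 1) / m) := by
  refine ContinuousOn.intervalIntegrable ?_
  rw [uIcc_of_le (cell_le m i)]
  exact hf.mono (cell_subset hi)

theorem intervalIntegrable_fun_sum {ι : Type*} (I : Finset ι) {f : ι → ℝ → ℝ} {a b : ℝ}
    (h : ∀ i ∈ I, IntervalIntegrable (f i) volume a b) :
    IntervalIntegrable (fun t => ∑ i ∈ I, f i t) volume a b := by
  have := IntervalIntegrable.sum I h
  simpa only [Finset.sum_fn] using this

theorem integral_eq_sum_cellInt (hm : 1 ≤ m) {f : ℝ → ℝ} (hf : ContinuousOn f (Icc 0 1)) :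
    ∫ t in (0 : ℝ)..1, f t = ∑ i ∈ Finset.range m, cellInt m i f := by
  have hm0 : (m : ℝ) ≠ 0 := by positivity
  have := intervalIntegral.sum_integral_adjacent_intervals (f := f) (μ := volume) (n := m)
    (a := fun i : ℕ => (i : ℝ) / m) fun i hi => by
      simpa using intervalIntegrable_cell hi hf
  simpa [hm0] using this.symm

theorem integral_mul_meshFun {i : ℕ} (hi : i < m) (f : ℝ → ℝ) :
    ∫ t in (0 : ℝ)..1, f t * meshFun m i t = √(m : ℝ) * cellInt m i f := by
  have h1 : (fun t => f t * meshFun m i t) =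
      (Ico ((i : ℝ) / m) (((i : ℝ) + 1) / m)).indicator fun t => √(m : ℝ) * f t := by
    ext t
    by_cases ht : t ∈ Ico ((i : ℝ) / m) (((i : ℝ) + 1) / m)
    · rw [meshFun, indicator_of_mem ht, indicator_of_mem ht, mul_comm]
    · rw [meshFun, indicator_of_notMem ht, indicator_of_notMem ht, mul_zero]
  have h2 : Icc (0 : ℝ) 1 ∩ Ico ((i : ℝ) / m) (((i : ℝ) + 1) / m) =
      Ico ((i : ℝ) / m) (((i : ℝ) + 1) / m) :=
    inter_eq_right.2 (Ico_subset_Icc_self.trans (cell_subset hi))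
  rw [← integral_unitVol, h1, setIntegral_indicator measurableSet_Ico, h2, integral_const_mul,
    integral_Ico_eq_integral_Ioo, ← integral_Ioc_eq_integral_Ioo, cellInt,
    intervalIntegral.integral_of_le (cell_le m i)]

theorem integral_meshFun_mul_meshFun {i j : ℕ} (hi : i < m) :
    ∫ t in (0 : ℝ)..1, meshFun m i t * meshFun m j t = if i = j then 1 else 0 := by
  have hm : (0 : ℝ) < m := by exact_mod_cast (Nat.zero_le i).trans_lt hi
  split_ifs with h
  · subst h
    rw [integral_mul_meshFun hi, cellInt, intervalIntegral.integral_of_le (cell_le m i),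
      integral_Ioc_eq_integral_Ioo, ← integral_Ico_eq_integral_Ioo, meshFun,
      setIntegral_indicator measurableSet_Ico, inter_self, setIntegral_const]
    rw [Real.volume_real_Ico_of_le (cell_le m i), smul_eq_mul, mul_left_comm,
      Real.mul_self_sqrt hm.le]
    field_simp
    simp
  · have h1 : ∀ t, meshFun m i t * meshFun m j t = 0 := by
      intro t
      rw [meshFun, meshFun]
      by_cases h1 : t ∈ Ico ((i : ℝ) / m) (((i : ℝ) + 1) / m)
      · rw [indicator_of_notMem (s := Ico ((j : ℝ) / m) (((j : ℝ) + 1) / m)), mul_zero]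
        intro h2
        have a1 := (div_le_iff₀ hm).1 h1.1
        have a2 := (lt_div_iff₀ hm).1 h1.2
        have b1 := (div_le_iff₀ hm).1 h2.1
        have b2 := (lt_div_iff₀ hm).1 h2.2
        have c1 : (i : ℝ) < (j : ℝ) + 1 := by linarith
        have c2 : (j : ℝ) < (i : ℝ) + 1 := by linarith
        have c3 : i < j + 1 := by exact_mod_cast c1
        have c4 : j < i + 1 := by exact_mod_cast c2
        omega
      · rw [indicator_of_notMem h1, zero_mul]
    simp [h1]

theorem intervalIntegrable_meshFun_mul (i j : ℕ) :
    IntervalIntegrable (fun t => meshFun m i t * meshFun m j t) volume 0 1 := by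
  have h : ∀ i, MemLp (meshFun m i) 2 unitVol := fun i =>
    (memLp_const _).indicator measurableSet_Ico
  rw [intervalIntegrable_iff_integrableOn_Icc_of_le zero_le_one]
  exact (h i).integrable_mul (h j)

theorem covMesh_eq (β : ℝ) (e : HilbertBasis ℕ ℝ L2) (n l : ℕ) :
    covMesh β e m n l =
      ∑ i ∈ Finset.range m, m * (cellInt m i (kFun β e n) * cellInt m i (kFun β e l)) := by
  unfold covMesh meshProj
  have h0 : ∀ i j, IntervalIntegrable (fun t => meshFun m i t * meshFun m j t) volume 0 1 :=
    intervalIntegrable_meshFun_mul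
  simp only [Finset.sum_mul_sum]
  have h1 : ∀ (i j : ℕ) (s : ℝ),
      ((∫ t in (0 : ℝ)..1, kFun β e n t * meshFun m i t) * meshFun m i s) *
        ((∫ t in (0 : ℝ)..1, kFun β e l t * meshFun m j t) * meshFun m j s) =
      ((∫ t in (0 : ℝ)..1, kFun β e n t * meshFun m i t) *
        (∫ t in (0 : ℝ)..1, kFun β e l t * meshFun m j t)) * (meshFun m i s * meshFun m j s) :=
    fun i j s => by ring
  simp only [h1]
  rw [intervalIntegral.integral_finsetSum fun i _ => intervalIntegrable_fun_sum _ fun j _ =>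
    (intervalIntegrable_meshFun_mul i j).const_mul _]
  refine Finset.sum_congr rfl fun i hi => ?_
  rw [intervalIntegral.integral_finsetSum fun j _ =>
    (intervalIntegrable_meshFun_mul i j).const_mul _]
  simp only [intervalIntegral.integral_const_mul,
    integral_meshFun_mul_meshFun (Finset.mem_range.1 hi), mul_ite, mul_one, mul_zero,
    Finset.sum_ite_eq, hi, if_true]
  rw [integral_mul_meshFun (Finset.mem_range.1 hi), integral_mul_meshFun (Finset.mem_range.1 hi),
    mul_mul_mul_comm, Real.mul_self_sqrt (Nat.cast_nonneg m)]

theorem cellInt_sub_sq {i : ℕ} (hi : i < m) {f : ℝ → ℝ} (hf : ContinuousOn f (Icc 0 1)) (c : ℝ) :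
    cellInt m i (fun t => (f t - c) ^ 2) =
      cellInt m i (fun t => f t ^ 2) - 2 * c * cellInt m i f + c ^ 2 / m := by
  have h1 : ∀ t, (f t - c) ^ 2 = f t ^ 2 - 2 * c * f t + c ^ 2 := fun t => by ring
  simp only [cellInt, h1]
  have i1 : IntervalIntegrable (fun t => f t ^ 2) volume ((i : ℝ) / m) (((i : ℝ) + 1) / m) :=
    intervalIntegrable_cell hi (hf.pow 2)
  have i2 := (intervalIntegrable_cell hi hf).const_mul (2 * c)
  have i3 : IntervalIntegrable (fun t => f t ^ 2 - 2 * c * f t) volume ((i : ℝ) / m)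
    (((i : ℝ) + 1) / m) := i1.sub i2
  rw [intervalIntegral.integral_add i3 (by simp), intervalIntegral.integral_sub i1 i2,
    intervalIntegral.integral_const_mul, intervalIntegral.integral_const, smul_eq_mul]
  ring

/-- The cell has length `1/m`, so the left side is the variance over the cell times that length; the
mean is the best constant approximation. -/
theorem cellInt_sq_sub_le {i : ℕ} (hi : i < m) {f : ℝ → ℝ} (hf : ContinuousOn f (Icc 0 1))
    (c : ℝ) : cellInt m i (fun t => f t ^ 2) - m * cellInt m i f ^ 2 ≤
      cellInt m i (fun t => (f t - c) ^ 2) := by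
  have hm : (0 : ℝ) < m := by exact_mod_cast (Nat.zero_le i).trans_lt hi
  rw [cellInt_sub_sq hi hf]
  have h : c ^ 2 / m - 2 * c * cellInt m i f + m * cellInt m i f ^ 2 =
      (c - m * cellInt m i f) ^ 2 / m := by
    field_simp
    ring
  have h2 : 0 ≤ (c - m * cellInt m i f) ^ 2 / m := by positivity
  linarith

theorem cellInt_sq_sub_nonneg {i : ℕ} (hi : i < m) {f : ℝ → ℝ} (hf : ContinuousOn f (Icc 0 1)) :
    0 ≤ cellInt m i (fun t => f t ^ 2) - m * cellInt m i f ^ 2 := by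
  have hm : (0 : ℝ) < m := by exact_mod_cast (Nat.zero_le i).trans_lt hi
  have h := cellInt_sub_sq hi hf (m * cellInt m i f)
  have h2 : 0 ≤ cellInt m i (fun t => (f t - m * cellInt m i f) ^ 2) :=
    intervalIntegral.integral_nonneg (cell_le m i) fun t _ => sq_nonneg _
  rw [h] at h2
  have h3 : (m * cellInt m i f) ^ 2 / m = m * cellInt m i f ^ 2 := by field_simp
  rw [h3] at h2
  linarith

variable {β : ℝ} (e : HilbertBasis ℕ ℝ L2)

theorem covLimit_sub_covMesh (hβ0 : 0 ≤ β) (hβ : β < 1 / 2) (hm : 1 ≤ m) (n l : ℕ) :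
    covLimit β e n l - covMesh β e m n l = ∑ i ∈ Finset.range m,
      (cellInt m i (fun t => kFun β e n t * kFun β e l t) -
        m * (cellInt m i (kFun β e n) * cellInt m i (kFun β e l))) := by
  have hc : ContinuousOn (fun t => kFun β e n t * kFun β e l t) (Icc 0 1) :=
    (continuousOn_kFun hβ0 hβ e n).mul (continuousOn_kFun hβ0 hβ e l)
  rw [covLimit, integral_eq_sum_cellInt hm hc, covMesh_eq,
    Finset.sum_sub_distrib]

/-- The quadratic form at `v` is the sum over the cells of the unnormalised variances of `f = ∑ v_a
k_a`. -/
theorem covLimit_sub_covMesh_quadratic_nonneg (hβ0 : 0 ≤ β) (hβ : β < 1 / 2) (hm : 1 ≤ m)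
    (N : ℕ) (v : ℕ → ℝ) :
    0 ≤ ∑ a ∈ Finset.range N, ∑ b ∈ Finset.range N,
      v a * v b * (covLimit β e a b - covMesh β e m a b) := by
  have hk := continuousOn_kFun hβ0 hβ e
  set f : ℝ → ℝ := fun t => ∑ a ∈ Finset.range N, v a * kFun β e a t with hf
  have hfc : ContinuousOn f (Icc 0 1) :=
    continuousOn_finsetSum _ fun a _ => (hk a).const_smul (v a)
  have h1 : ∀ i < m, cellInt m i f = ∑ a ∈ Finset.range N, v a * cellInt m i (kFun β e a) := by
    intro i hi
    simp only [cellInt, hf]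
    rw [intervalIntegral.integral_finsetSum fun a _ =>
      (intervalIntegrable_cell hi (hk a)).const_mul _]
    simp only [intervalIntegral.integral_const_mul]
  have h2 : ∀ i < m, cellInt m i (fun t => f t ^ 2) = ∑ a ∈ Finset.range N, ∑ b ∈ Finset.range N,
      v a * v b * cellInt m i (fun t => kFun β e a t * kFun β e b t) := by
    intro i hi
    have h3 : ∀ t, f t ^ 2 = ∑ a ∈ Finset.range N, ∑ b ∈ Finset.range N,
        v a * v b * (kFun β e a t * kFun β e b t) := by
      intro t
      simp only [hf, sq, Finset.sum_mul_sum]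
      exact Finset.sum_congr rfl fun a _ => Finset.sum_congr rfl fun b _ => by ring
    have h4 : ∀ a b, IntervalIntegrable (fun t => kFun β e a t * kFun β e b t) volume
        ((i : ℝ) / m) (((i : ℝ) + 1) / m) :=
      fun a b => intervalIntegrable_cell hi ((hk a).mul (hk b))
    simp only [cellInt, h3]
    rw [intervalIntegral.integral_finsetSum fun a _ => intervalIntegrable_fun_sum _ fun b _ =>
      (h4 a b).const_mul _]
    refine Finset.sum_congr rfl fun a _ => ?_
    rw [intervalIntegral.integral_finsetSum fun b _ => (h4 a b).const_mul _]
    simp only [intervalIntegral.integral_const_mul]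
  have h5 : ∑ a ∈ Finset.range N, ∑ b ∈ Finset.range N,
      v a * v b * (covLimit β e a b - covMesh β e m a b) =
      ∑ i ∈ Finset.range m, (cellInt m i (fun t => f t ^ 2) - m * cellInt m i f ^ 2) := by
    simp only [covLimit_sub_covMesh e hβ0 hβ hm, Finset.mul_sum]
    have h6 : ∀ a, ∑ b ∈ Finset.range N, ∑ i ∈ Finset.range m, v a * v b *
        (cellInt m i (fun t => kFun β e a t * kFun β e b t) -
          m * (cellInt m i (kFun β e a) * cellInt m i (kFun β e b))) =
        ∑ i ∈ Finset.range m, ∑ b ∈ Finset.range N, v a * v b *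
        (cellInt m i (fun t => kFun β e a t * kFun β e b t) -
          m * (cellInt m i (kFun β e a) * cellInt m i (kFun β e b))) := fun a => Finset.sum_comm
    simp only [h6]
    rw [Finset.sum_comm]
    refine Finset.sum_congr rfl fun i hi => ?_
    have hi' := Finset.mem_range.1 hi
    rw [h1 i hi', h2 i hi', sq, Finset.sum_mul_sum, Finset.mul_sum, ← Finset.sum_sub_distrib]
    refine Finset.sum_congr rfl fun a _ => ?_
    rw [Finset.mul_sum, ← Finset.sum_sub_distrib]
    exact Finset.sum_congr rfl fun b _ => by ring
  rw [h5]
  exact Finset.sum_nonneg fun i hi => cellInt_sq_sub_nonneg (Finset.mem_range.1 hi) hfc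

theorem covLimit_sub_covMesh_diag_nonneg (hβ0 : 0 ≤ β) (hβ : β < 1 / 2) (hm : 1 ≤ m) (n : ℕ) :
    0 ≤ covLimit β e n n - covMesh β e m n n := by
  rw [covLimit_sub_covMesh e hβ0 hβ hm]
  refine Finset.sum_nonneg fun i hi => ?_
  simp only [← sq]
  exact cellInt_sq_sub_nonneg (Finset.mem_range.1 hi) (continuousOn_kFun hβ0 hβ e n)

theorem abs_covDiff_diag (hβ0 : 0 ≤ β) (hβ : β < 1 / 2) (hm : 1 ≤ m) (n : ℕ) :
    |covDiff β e m n n| = covLimit β e n n - covMesh β e m n n := by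
  rw [covDiff, abs_sub_comm, abs_of_nonneg (covLimit_sub_covMesh_diag_nonneg e hβ0 hβ hm n)]

/-- On each cell the variance of `k_n` is compared with the deviation from the value at the left
endpoint. The Hölder bound, summed over `n`, gives `m^{-(1-2β)}` times the length `1/m`, and there
are `m` cells. -/
theorem sum_abs_covDiff_le (hβ0 : 0 ≤ β) (hβ : β < 1 / 2) (hm : 1 ≤ m) (I : Finset ℕ) :
    ∑ n ∈ I, |covDiff β e m n n| ≤ kConst β * (m : ℝ) ^ (-(1 - 2 * β)) := by
  have hm0 : (0 : ℝ) < m := by exact_mod_cast hm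
  have hp : 0 < 1 - 2 * β := by linarith
  have hk := continuousOn_kFun hβ0 hβ e
  have hcell : ∀ i < m, ∑ n ∈ I, (cellInt m i (fun t => kFun β e n t * kFun β e n t) -
      m * (cellInt m i (kFun β e n) * cellInt m i (kFun β e n))) ≤
      kConst β * (m : ℝ) ^ (-(1 - 2 * β)) / m := by
    intro i hi
    have hc : ∀ n, ContinuousOn (fun t => (kFun β e n t - kFun β e n (i / m)) ^ 2) (Icc 0 1) :=
      fun n => ((hk n).sub continuousOn_const).pow 2
    calc _ ≤ ∑ n ∈ I, cellInt m i (fun t => (kFun β e n t - kFun β e n (i / m)) ^ 2) := by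
          refine Finset.sum_le_sum fun n _ => ?_
          have := cellInt_sq_sub_le hi (hk n) (kFun β e n (i / m))
          simpa only [sq] using this
      _ = cellInt m i fun t => ∑ n ∈ I, (kFun β e n t - kFun β e n (i / m)) ^ 2 := by
          rw [cellInt, intervalIntegral.integral_finsetSum fun n _ =>
            intervalIntegrable_cell hi (hc n)]
      _ ≤ cellInt m i fun _ => kConst β * (m : ℝ) ^ (-(1 - 2 * β)) := by
          refine intervalIntegral.integral_mono_on (cell_le m i)
            (intervalIntegrable_cell hi (continuousOn_finsetSum _ fun n _ => hc n)) (by simp)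
            fun t ht => ?_
          refine (sum_kFun_sub_sq_le hβ0 hβ (cell_subset hi ht)
            (cell_subset hi ⟨le_rfl, cell_le m i⟩) e I).trans ?_
          refine mul_le_mul_of_nonneg_left ?_ (kConst_nonneg hβ)
          rw [Real.rpow_neg hm0.le, ← Real.inv_rpow hm0.le]
          refine Real.rpow_le_rpow (abs_nonneg _) ?_ hp.le
          rw [abs_of_nonneg (by linarith [ht.1])]
          have := ht.2
          rw [add_div, one_div] at this
          linarith
      _ = kConst β * (m : ℝ) ^ (-(1 - 2 * β)) / m := by
          rw [cellInt, intervalIntegral.integral_const, smul_eq_mul]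
          ring
  simp only [abs_covDiff_diag e hβ0 hβ hm, covLimit_sub_covMesh e hβ0 hβ hm]
  rw [Finset.sum_comm]
  refine (Finset.sum_le_sum fun i hi => hcell i (Finset.mem_range.1 hi)).trans_eq ?_
  rw [Finset.sum_const, Finset.card_range, nsmul_eq_mul]
  field_simp

theorem summable_abs_covDiff (hβ0 : 0 ≤ β) (hβ : β < 1 / 2) (hm : 1 ≤ m) :
    Summable fun n => |covDiff β e m n n| :=
  summable_of_sum_le (fun _ => abs_nonneg _) (sum_abs_covDiff_le e hβ0 hβ hm)

theorem gammaMesh_le (hβ0 : 0 ≤ β) (hβ : β < 1 / 2) (hm : 1 ≤ m) :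
    gammaMesh β e m ≤ kConst β * (m : ℝ) ^ (-(1 - 2 * β)) :=
  Real.tsum_le_of_sum_le (fun _ => abs_nonneg _) (sum_abs_covDiff_le e hβ0 hβ hm)

theorem gammaMesh_nonneg (β : ℝ) (m : ℕ) : 0 ≤ gammaMesh β e m := tsum_nonneg fun _ => abs_nonneg _

theorem covDiff_symm (β : ℝ) (m a b : ℕ) : covDiff β e m a b = covDiff β e m b a := by
  simp only [covDiff, covMesh, covLimit, mul_comm]

/-- A positive semidefinite matrix satisfies `T_ab² ≤ T_aa T_bb`; summing bounds the Hilbert–Schmidt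
norm by the trace. -/
theorem hsBound_covDiff (hβ0 : 0 ≤ β) (hβ : β < 1 / 2) (hm : 1 ≤ m) :
    HSBound (covDiff β e m) (gammaMesh β e m) := by
  intro N
  obtain ⟨d, c, hc⟩ := exists_factorization (T := fun a b => covLimit β e a b - covMesh β e m a b)
    (fun a b => by have := covDiff_symm e β m a b; unfold covDiff at this; linarith) N
    (covLimit_sub_covMesh_quadratic_nonneg e hβ0 hβ hm N)
  have h1 : ∀ a < N, ∀ b < N, covDiff β e m a b ^ 2 ≤
      |covDiff β e m a a| * |covDiff β e m b b| := by
    intro a ha b hb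
    rw [abs_covDiff_diag e hβ0 hβ hm, abs_covDiff_diag e hβ0 hβ hm, ← hc a ha a ha, ← hc b hb b hb]
    have h2 : covDiff β e m a b ^ 2 = (∑ i, c i a * c i b) ^ 2 := by
      rw [hc a ha b hb, covDiff]; ring
    rw [h2]
    simpa only [sq] using Finset.sum_mul_sq_le_sq_mul_sq Finset.univ (fun i => c i a) fun i => c i b
  calc ∑ a ∈ Finset.range N, ∑ b ∈ Finset.range N, covDiff β e m a b ^ 2
      ≤ ∑ a ∈ Finset.range N, ∑ b ∈ Finset.range N, |covDiff β e m a a| * |covDiff β e m b b| :=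
        Finset.sum_le_sum fun a ha => Finset.sum_le_sum fun b hb =>
          h1 a (Finset.mem_range.1 ha) b (Finset.mem_range.1 hb)
    _ = (∑ a ∈ Finset.range N, |covDiff β e m a a|) ^ 2 := by rw [sq, Finset.sum_mul_sum]
    _ ≤ gammaMesh β e m ^ 2 := by
        refine pow_le_pow_left₀ (Finset.sum_nonneg fun _ _ => abs_nonneg _) ?_ 2
        exact (summable_abs_covDiff e hβ0 hβ hm).sum_le_tsum _ fun _ _ => abs_nonneg _

end Cells

/-! ### The law of the interpolated Brownian motion -/

section Mesh

variable {m : ℕ} {Ω : Type*} [MeasurableSpace Ω] {B : ℝ≥0 → Ω → ℝ} {P : Measure Ω}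

theorem cellVec_apply {β : ℝ} (hβ0 : 0 ≤ β) (hβ : β < 1 / 2) (hβ1 : β < 1)
    (e : HilbertBasis ℕ ℝ L2) {i : ℕ} (hi : i < m) (n : ℕ) :
    cellVec hβ1 e m i n = cellInt m i (kFun β e n) := by
  have hk := continuousOn_kFun hβ0 hβ e n
  have h0 : (i : ℝ) / m ∈ Icc (0 : ℝ) 1 := cell_subset hi ⟨le_rfl, cell_le m i⟩
  have h1 : ((i : ℝ) + 1) / m ∈ Icc (0 : ℝ) 1 := cell_subset hi ⟨cell_le m i, le_rfl⟩
  have hint : ∀ a ∈ Icc (0 : ℝ) 1, IntervalIntegrable (kFun β e n) volume a 1 := fun a ha =>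
    (hk.mono (by rw [uIcc_of_le ha.2]; exact Icc_subset_Icc ha.1 le_rfl)).intervalIntegrable
  rw [cellVec, HilbertBasis.repr_apply_apply, inner_sub_right, inner_rampLp hβ1 h0,
    inner_rampLp hβ1 h1, sub_eq_iff_eq_add,
    intervalIntegral.integral_add_adjacent_intervals (intervalIntegrable_cell hi hk) (hint _ h1)]

theorem hasLaw_increment (hB : IsBrownianReal B P) {i : ℕ} (hm : 1 ≤ m) :
    HasLaw (fun ω => √(m : ℝ) * (B (((i : ℝ≥0) + 1) / m) ω - B ((i : ℝ≥0) / m) ω))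
      (gaussianReal 0 1) P := by
  have h := gaussianReal_const_mul
    (hB.toIsPreBrownianReal.hasLaw_sub (((i : ℝ≥0) + 1) / m) ((i : ℝ≥0) / m)) (√(m : ℝ))
  convert h using 2
  · simp
  · simp
  · have hm' : (0 : ℝ) < m := by exact_mod_cast hm
    ext
    simp only [NNReal.coe_one, NNReal.coe_mul, coe_nndist, Real.dist_eq, NNReal.coe_mk]
    rw [Real.sq_sqrt hm'.le]
    simp only [NNReal.val_eq_coe]
    push_cast
    rw [← sub_div, add_sub_cancel_left, abs_of_pos (by positivity)]
    field_simp

theorem hasLaw_increments (hB : IsBrownianReal B P) (hm : 1 ≤ m) :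
    HasLaw (fun ω (i : Fin m) =>
      √(m : ℝ) * (B (((i : ℕ) + 1) / m) ω - B ((i : ℕ) / m) ω)) (gaussPi m) P := by
  have hP : IsProbabilityMeasure P := hB.toIsPreBrownianReal.isGaussianProcess.isProbabilityMeasure
  have hl := fun i : ℕ => hasLaw_increment (i := i) hB hm
  have hmeas : ∀ i : Fin m, AEMeasurable (fun ω =>
      √(m : ℝ) * (B (((i : ℕ) + 1) / m) ω - B ((i : ℕ) / m) ω)) P := fun i => (hl i).aemeasurable
  refine ⟨aemeasurable_pi_lambda _ hmeas, ?_⟩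
  have hind := hB.toIsPreBrownianReal.hasIndepIncrements m (fun i => (i : ℕ) / m)
    (fun a b hab => by
      have : ((a : ℕ) : ℝ≥0) ≤ ((b : ℕ) : ℝ≥0) := by exact_mod_cast hab
      dsimp only
      gcongr)
  have h2 := hind.comp (fun _ x => √(m : ℝ) * x) (fun _ => by fun_prop)
  simp only [Function.comp_def, Fin.val_succ, Fin.val_castSucc, Nat.cast_add, Nat.cast_one] at h2
  rw [(iIndepFun_iff_map_fun_eq_pi_map hmeas).1 h2]
  simp only [(hl _).map_eq]

/-- The law is the image of the standard Gaussian on `ℝ^m` under a linear map. The weight `m` of an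
increment splits as `√m · √m`: one factor normalises the increment, whose variance is `1/m`, the
other goes into `q`. -/
theorem isCenteredGaussian_lawMesh {β : ℝ} (hβ0 : 0 ≤ β) (hβ : β < 1 / 2)
    (e : HilbertBasis ℕ ℝ L2) (hB : IsBrownianReal B P) (hm : 1 ≤ m) :
    IsCenteredGaussian (lawMesh β e m B P) (covMesh β e m) := by
  have hβ1 : β < 1 := by linarith
  set q : Fin m → l2 := fun i => √(m : ℝ) • cellVec hβ1 e m i with hq
  have hlaw := hasLaw_increments hB hm
  have hmap : lawMesh β e m B P = (gaussPi m).map (combo q) := by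
    rw [← hlaw.map_eq, AEMeasurable.map_map_of_aemeasurable (by fun_prop) hlaw.aemeasurable,
      lawMesh]
    congr 1
    funext ω
    simp only [isoJ_interp hβ0 hβ, Function.comp_apply, combo_apply, hq, smul_smul]
    rw [← Fin.sum_univ_eq_sum_range (fun i : ℕ =>
      ((m : ℝ) * (B (((i : ℝ≥0) + 1) / m) ω - B ((i : ℝ≥0) / m) ω)) • cellVec hβ1 e m i)]
    refine Finset.sum_congr rfl fun i _ => ?_
    congr 1
    rw [mul_right_comm, Real.mul_self_sqrt (Nat.cast_nonneg m)]
  have hgauss : IsGaussian ((gaussPi m).map (combo q)) := inferInstance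
  rw [hmap]
  refine ⟨hgauss, fun n => ?_, fun n l => ?_⟩
  · refine (integral_map (f := coordCLM n) (combo q).continuous.aemeasurable
      (coordCLM n).continuous.aestronglyMeasurable).trans ?_
    exact integral_combo q (coordCLM n)
  · have hcov : ∀ L : l2 →L[ℝ] ℝ, ∫ ξ, L (combo q ξ) ^ 2 ∂gaussPi m = ∑ i, L (q i) ^ 2 :=
      fun L => by rw [← variance_combo, variance_of_integral_eq_zero (by fun_prop)
        (integral_combo q L)]
    have hi : ∀ L : l2 →L[ℝ] ℝ, Integrable (fun ξ => L (combo q ξ) ^ 2) (gaussPi m) := fun L =>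
      (IsGaussian.memLp_dual (gaussPi m) (L.comp (combo q)) 2 (by simp)).integrable_sq
    have hc : Continuous fun x : l2 => x n * x l :=
      (coordCLM n).continuous.mul (coordCLM l).continuous
    rw [integral_map (by fun_prop) hc.aestronglyMeasurable]
    -- Polarization: `variance_combo` gives second moments of single linear forms only.
    have h1 : ∀ ξ, (combo q ξ) n * (combo q ξ) l = 1 / 4 *
        ((coordCLM n + coordCLM l) (combo q ξ) ^ 2 -
          (coordCLM n - coordCLM l) (combo q ξ) ^ 2) := by
      intro ξ
      simp only [add_apply, sub_apply, coordCLM_apply]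
      ring
    simp only [h1]
    rw [integral_const_mul, integral_sub (hi _) (hi _), hcov, hcov, covMesh_eq,
      ← Finset.sum_sub_distrib, Finset.mul_sum,
      ← Fin.sum_univ_eq_sum_range (fun i : ℕ =>
        (m : ℝ) * (cellInt m i (kFun β e n) * cellInt m i (kFun β e l)))]
    refine Finset.sum_congr rfl fun i _ => ?_
    have h2 : ∀ a, (q i) a = √(m : ℝ) * cellInt m i (kFun β e a) := fun a => by
      rw [← cellVec_apply hβ0 hβ hβ1 e i.2 a]; rfl
    simp only [add_apply, sub_apply, coordCLM_apply, h2]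
    linear_combination (cellInt m i (kFun β e n) * cellInt m i (kFun β e l)) *
      Real.mul_self_sqrt (Nat.cast_nonneg m)

end Mesh

end SteinExpansion

/-! ### Assembly: the expansion and the rate -/

theorem mainTheorem2 (β : ℝ) (hβ0 : 0 ≤ β) (hβ : β < 1 / 2) :
    -- the expansion and the bound of its remainder
    (∀ (e : HilbertBasis ℕ ℝ L2) {Ω : Type*} [MeasurableSpace Ω] (P : Measure Ω)
        (B : ℝ≥0 → Ω → ℝ), IsBrownianReal B P →
      ∀ mβ : Measure l2, IsCenteredGaussian mβ (covLimit β e) →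
      ∀ m : ℕ, 1 ≤ m →
        Summable (fun n => |covDiff β e m n n|) ∧
        IsProbabilityMeasure (lawMesh β e m B P) ∧
        ∀ (s : ℕ) (F : l2 → ℝ), MemCb (2 * s + 2) F →
          Integrable F (lawMesh β e m B P) ∧
          (∀ j ≤ s,
            (∀ u, Summable (pairingTerm (iteratedFDeriv ℝ (2 * j) F u) (covDiff β e m))) ∧
            Integrable (fun u => pairing (iteratedFDeriv ℝ (2 * j) F u) (covDiff β e m)) mβ) ∧
          |∫ u, F u ∂(lawMesh β e m B P) -
              ∑ j ∈ Finset.range (s + 1), 1 / (2 ^ j * (j.factorial : ℝ)) *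
                ∫ u, pairing (iteratedFDeriv ℝ (2 * j) F u) (covDiff β e m) ∂mβ| ≤
            gammaMesh β e m ^ (s + 1) / 2 ^ (s + 1) * cbNorm (2 * s + 2) F) ∧
    -- the rate of the constant in the bound
    (∀ ε : ℝ, 0 < ε → ε < 1 / 2 - β → ∃ C : ℝ, ∀ (e : HilbertBasis ℕ ℝ L2) (m : ℕ), 1 ≤ m →
      gammaMesh β e m ≤ C * (m : ℝ) ^ (-(1 / 2 - β - ε))) := by
  refine ⟨fun e Ω _ P B hB mβ hmβ m hm => ?_, fun ε hε _ => ⟨kConst β, fun e m hm => ?_⟩⟩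
  · have hν := isCenteredGaussian_lawMesh hβ0 hβ e hB hm
    have hνg := hν.gaussian
    have hmβg := hmβ.gaussian
    have hg := gammaMesh_nonneg e β m
    have hT := hsBound_covDiff e hβ0 hβ hm
    refine ⟨summable_abs_covDiff e hβ0 hβ hm, inferInstance, fun s F hF =>
      ⟨hF.integrable (by omega) _, fun j hj =>
        ⟨fun u => summable_pairingTerm hF hT (by omega) u,
          integrable_pairing hF hg hT (by omega) mβ⟩, ?_⟩⟩
    exact expansion_of_isCenteredGaussian hν hmβ
      (covLimit_sub_covMesh_quadratic_nonneg e hβ0 hβ hm) hg hT hF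
  -- The exponent obtained, `1 - 2β = 2(1/2 - β)`, exceeds the one required, so `C = kConst β`
  -- serves for every `ε`.
  · refine (gammaMesh_le e hβ0 hβ hm).trans
      (mul_le_mul_of_nonneg_left ?_ (kConst_nonneg hβ))
    exact Real.rpow_le_rpow_of_exponent_le (by exact_mod_cast hm) (by linarith)
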